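/- For $\tau\in\mathbb C$ with $\operatorname{Im}\tau>0$ and $z\in\mathbb C$ write $q=e^{2\pi i\tau}$, $\zeta=e^{2\pi i z}$, $\zeta^{1/2}=e^{\pi i z}$, $q^{-1/24}=e^{-2\pi i\tau/24}$, and let $(a;q)_n=\prod_{j=0}^{n-1}(1-aq^j)$ for $n\in\mathbb N_0\cup\{\infty\}$. Let $$\mathcal R(\zeta;q)=\sum_{n\ge 0}\frac{q^{n^2}}{(\zeta q;q)_n(\zeta^{-1}q;q)_n},\qquad \mathcal C(\zeta;q)=\frac{(q;q)_\infty}{(\zeta q;q)_\infty(\zeta^{-1}q;q)_\infty}$$ be the rank and crank generating functions, let $$\mathcal R^*(\zeta;q)=\frac{\zeta^{1/2}q^{-1/24}}{1-\zeta}\,\mathcal R(\zeta;q),\qquad \mathcal C^*(\zeta;q)=\frac{\zeta^{1/2}q^{-1/24}}{1-\zeta}\,\mathcal C(\zeta;q)$$ be their normalized versions (viewed as functions of $z$ and $\tau$), let $\eta(\tau)=e^{2\pi i\tau/24}(q;q)_\infty$ be the Dedekind eta function, and let $\mathcal D_x=\frac1{2\pi i}\frac{\partial}{\partial x}$. Then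 for all $\tau$ with $\operatorname{Im}\tau>0$ and all $z\in\mathbb C\setminus(\mathbb Z\tau+\mathbb Z)$, the series $\mathcal R(\zeta;q)$ converges absolutely, $\mathcal R^*$ is complex differentiable in $\tau$ and analytic in $z$ at $(z,\tau)$, and the rank--crank PDE of Atkin and Garvan holds: $$2\,\eta(\tau)^2\,\mathcal C^*(\zeta;q)^3=\left(6\mathcal D_\tau+\mathcal D_z^2\right)\mathcal R^*(\zeta;q).$$ -/

import Mathlib

noncomputable section

/-- `e(x) = exp(2πix)`. -/
def e (x : ℂ) : ℂ := Complex.exp (2 * Real.pi * Complex.I * x)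

/-- The finite `q`-Pochhammer symbol `(a;q)_n = ∏_{j=0}^{n-1} (1 - a q^j)`. -/
def qPoch (a q : ℂ) (n : ℕ) : ℂ := ∏ j ∈ Finset.range n, (1 - a * q ^ j)

/-- The infinite `q`-Pochhammer symbol `(a;q)_∞ = ∏_{j≥0} (1 - a q^j)` (for `|q| < 1`). -/
def qPochInf (a q : ℂ) : ℂ := ∏' j : ℕ, (1 - a * q ^ j)

/-- The product defining `(a;q)_∞` converges for `|q| < 1`. -/
theorem multipliable_qPochInf (a : ℂ) {q : ℂ} (hq : ‖q‖ < 1) :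
    Multipliable fun j : ℕ => 1 - a * q ^ j := by
  have h : Summable fun j : ℕ => ‖-(a * q ^ j)‖ := by
    simpa using (summable_geometric_of_lt_one (norm_nonneg q) hq).mul_left ‖a‖
  simpa [sub_eq_add_neg] using multipliable_one_add_of_summable h

/-- The `n`-th term of the rank generating function. -/
def rankTerm (ζ q : ℂ) (n : ℕ) : ℂ :=
  q ^ (n ^ 2) / (qPoch (ζ * q) q n * qPoch (ζ⁻¹ * q) q n)

/-- The rank generating function
`R(ζ;q) = ∑_{n≥0} q^{n²} / ((ζq;q)_n (ζ⁻¹q;q)_n)`. -/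
def rankGen (ζ q : ℂ) : ℂ := ∑' n : ℕ, rankTerm ζ q n

/-- The crank generating function `C(ζ;q) = (q;q)_∞ / ((ζq;q)_∞ (ζ⁻¹q;q)_∞)`. -/
def crankGen (ζ q : ℂ) : ℂ :=
  qPochInf q q / (qPochInf (ζ * q) q * qPochInf (ζ⁻¹ * q) q)

/-- The normalized rank generating function
`R*(ζ;q) = ζ^{1/2} q^{-1/24} / (1 - ζ) · R(ζ;q)` with `ζ = e(z)`, `q = e(τ)`,
`ζ^{1/2} = e(z/2)` and `q^{-1/24} = e(-τ/24)`. -/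
def rankStar (z τ : ℂ) : ℂ :=
  e (z / 2) * e (-τ / 24) / (1 - e z) * rankGen (e z) (e τ)

/-- The normalized crank generating function
`C*(ζ;q) = ζ^{1/2} q^{-1/24} / (1 - ζ) · C(ζ;q)`, with the same conventions. -/
def crankStar (z τ : ℂ) : ℂ :=
  e (z / 2) * e (-τ / 24) / (1 - e z) * crankGen (e z) (e τ)

/-- The operator `𝒟 = (1 / 2πi) d/dx` on functions of one complex variable. -/
def normDeriv (f : ℂ → ℂ) (x : ℂ) : ℂ := (2 * Real.pi * Complex.I)⁻¹ * deriv f x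

end

open Filter Topology

/-! Partial fractions turn each rank summand into a finite sum to which Bailey's lemma applies, and
the rank series becomes an Appell sum: `R* = A / η` with `A = ∑ (-1)^n q^{3n²/2} L(z + nτ)` and `L =
lerch` (`hasSum_rankTerm`, `rankStar_eq_appell_div_eta`).

On a term of `A` the operator `6𝒟_τ + 𝒟_z²` acts on `L` as the perfect square `(3n + 𝒟)²`. By the
quotient rule, `η` times its value on `R*` is `rankHeat`, that is `appellHeat - (6𝒟η/η) A`.

Under `z ↦ z + τ` the sum `A` acquires, besides a factor, multiples of the theta series `∑ (-1)^n
q^{(3n-a)²/6}` with `a = 1/2, 3/2, 5/2`. These equal `η` (pentagonal number theorem), `0` and `-η`.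
In `rankHeat` they carry the weight `(3n-a)² - 6𝒟η/η`, and then each of them sums to zero. So
`rankHeat` is truly quasi-periodic (`rankHeat_add_tau`), with the same factors as `(η C*)³`.

The only poles are at lattice points. There `𝒟²L = L/4 + 2L³` (`lerchDD_eq`), while `η C*` behaves
like `L`, so `rankHeat / (η C*)³` is elliptic without poles and tends to `2` at the origin. By
Liouville it is identically `2` (`rankHeat_mul_crankInv`), which is the PDE multiplied by `η`. -/

/-! ### Finite `q`-products and partial fractions -/

theorem qPoch_zero (a q : ℂ) : qPoch a q 0 = 1 := by simp [qPoch]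

theorem qPoch_succ (a q : ℂ) (n : ℕ) : qPoch a q (n + 1) = qPoch a q n * (1 - a * q ^ n) := by
  simp [qPoch, Finset.prod_range_succ]

theorem qPoch_succ' (a q : ℂ) (n : ℕ) : qPoch a q (n + 1) = (1 - a) * qPoch (a * q) q n := by
  simp [qPoch, Finset.prod_range_succ', pow_succ', mul_comm, mul_assoc]

theorem qPoch_ne_zero {a q : ℂ} {n : ℕ} (h : ∀ j < n, 1 - a * q ^ j ≠ 0) : qPoch a q n ≠ 0 :=
  Finset.prod_ne_zero_iff.2 fun j hj => h j (Finset.mem_range.1 hj)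

theorem one_sub_pow_ne_zero {q : ℂ} (hq : ‖q‖ < 1) (n : ℕ) : 1 - q ^ (n + 1) ≠ 0 := by
  intro h
  have h1 : ‖q ^ (n + 1)‖ = 1 := by rw [← sub_eq_zero.1 h, norm_one]
  rw [norm_pow] at h1
  exact (pow_lt_one₀ (norm_nonneg q) hq n.succ_ne_zero).ne h1

theorem qPoch_self_ne_zero {q : ℂ} (hq : ‖q‖ < 1) (n : ℕ) : qPoch q q n ≠ 0 :=
  qPoch_ne_zero fun j _ => by simpa [pow_succ'] using one_sub_pow_ne_zero hq j

theorem qPoch_self_succ (q : ℂ) (n : ℕ) : qPoch q q (n + 1) = qPoch q q n * (1 - q ^ (n + 1)) := by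
  rw [qPoch_succ, pow_succ']

/-- The coefficients `(-1)^i q^{i(i+1)/2} / ((q;q)_i (q;q)_{N-i})` of the partial fraction
decomposition of `1 / (x;q)_{N+1}`. -/
noncomputable def pfCoeff (q : ℂ) (N i : ℕ) : ℂ :=
  (-1) ^ i * q ^ ((i + 1).choose 2) / (qPoch q q i * qPoch q q (N - i))

theorem pfCoeff_succ_left {q : ℂ} (hq : ‖q‖ < 1) {N i : ℕ} (hi : i ≤ N) :
    pfCoeff q (N + 1) i * (1 - q ^ (N + 1 - i)) = pfCoeff q N i := by
  obtain ⟨m, rfl⟩ := Nat.exists_eq_add_of_le hi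
  rw [pfCoeff, pfCoeff, show i + m + 1 - i = m + 1 by omega, show i + m - i = m by omega,
    qPoch_self_succ]
  have h1 := qPoch_self_ne_zero hq i
  have h2 := qPoch_self_ne_zero hq m
  have h3 := one_sub_pow_ne_zero hq m
  field_simp

theorem pfCoeff_succ_succ {q : ℂ} (hq : ‖q‖ < 1) {N i : ℕ} :
    pfCoeff q (N + 1) (i + 1) * (1 - q ^ (i + 1)) = -(q ^ (i + 1) * pfCoeff q N i) := by
  rw [pfCoeff, pfCoeff, show N + 1 - (i + 1) = N - i by omega, qPoch_self_succ,
    show (i + 1 + 1).choose 2 = (i + 1) + (i + 1).choose 2 by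
      rw [Nat.choose_succ_succ' (i + 1) 1, Nat.choose_one_right]]
  have h1 := qPoch_self_ne_zero hq i
  have h2 := qPoch_self_ne_zero hq (N - i)
  have h3 := one_sub_pow_ne_zero hq i
  field_simp
  ring

/-- A `q`-Pascal rule: `1 - q^{N+1} = (1 - q^{N+1-i}) + (1 - q^i) q^{N+1-i}`, and each of the
factors `1 - q^{N+1-i}`, `1 - q^i` lowers `N + 1` to `N` in the coefficient. -/
theorem sum_pfCoeff_succ {q : ℂ} (hq : ‖q‖ < 1) (N : ℕ) (h : ℕ → ℂ) :
    (1 - q ^ (N + 1)) * ∑ i ∈ Finset.range (N + 2), pfCoeff q (N + 1) i * h i =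
      ∑ i ∈ Finset.range (N + 1), pfCoeff q N i * h i -
        q ^ (N + 1) * ∑ i ∈ Finset.range (N + 1), pfCoeff q N i * h (i + 1) := by
  have key : ∀ i ∈ Finset.range (N + 2), (1 - q ^ (N + 1)) * (pfCoeff q (N + 1) i * h i) =
      pfCoeff q (N + 1) i * (1 - q ^ (N + 1 - i)) * h i +
        pfCoeff q (N + 1) i * (1 - q ^ i) * q ^ (N + 1 - i) * h i := by
    intro i hi
    have hi : i ≤ N + 1 := by have := Finset.mem_range.1 hi; omega
    have : q ^ (N + 1) = q ^ i * q ^ (N + 1 - i) := by rw [← pow_add]; congr 1; omega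
    rw [this]; ring
  rw [Finset.mul_sum, Finset.sum_congr rfl key, Finset.sum_add_distrib, sub_eq_add_neg,
    Finset.mul_sum, ← Finset.sum_neg_distrib]
  congr 1
  · rw [Finset.sum_range_succ]
    simp only [Nat.sub_self, pow_zero, sub_self, mul_zero, zero_mul, add_zero]
    refine Finset.sum_congr rfl fun i hi => ?_
    rw [pfCoeff_succ_left hq (by have := Finset.mem_range.1 hi; omega)]
  · rw [Finset.sum_range_succ']
    simp only [pow_zero, sub_self, mul_zero, zero_mul, add_zero]
    refine Finset.sum_congr rfl fun i hi => ?_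
    have hi : i ≤ N := by have := Finset.mem_range.1 hi; omega
    rw [pfCoeff_succ_succ hq, show N + 1 - (i + 1) = N - i by omega,
      show q ^ (N + 1) = q ^ (i + 1) * q ^ (N - i) by rw [← pow_add]; congr 1; omega]
    ring

/-- The other `q`-Pascal rule, from `1 - q^{N+1} = q^i (1 - q^{N+1-i}) + (1 - q^i)`. -/
theorem sum_pfCoeff_inv_pow_succ {q : ℂ} (hq : ‖q‖ < 1) (hq0 : q ≠ 0) (N : ℕ) (h : ℕ → ℂ) :
    (1 - q ^ (N + 1)) * ∑ i ∈ Finset.range (N + 2), pfCoeff q (N + 1) i * (q⁻¹ ^ i * h i) =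
      ∑ i ∈ Finset.range (N + 1), pfCoeff q N i * h i -
        ∑ i ∈ Finset.range (N + 1), pfCoeff q N i * h (i + 1) := by
  have key : ∀ i ∈ Finset.range (N + 2),
      (1 - q ^ (N + 1)) * (pfCoeff q (N + 1) i * (q⁻¹ ^ i * h i)) =
      pfCoeff q (N + 1) i * (1 - q ^ (N + 1 - i)) * h i +
        pfCoeff q (N + 1) i * (1 - q ^ i) * q⁻¹ ^ i * h i := by
    intro i hi
    have hi : i ≤ N + 1 := by have := Finset.mem_range.1 hi; omega
    have : q ^ (N + 1) = q ^ i * q ^ (N + 1 - i) := by rw [← pow_add]; congr 1; omega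
    rw [this, inv_pow]
    have := pow_ne_zero i hq0
    field_simp
    ring
  rw [Finset.mul_sum, Finset.sum_congr rfl key, Finset.sum_add_distrib, sub_eq_add_neg,
    ← Finset.sum_neg_distrib]
  congr 1
  · rw [Finset.sum_range_succ]
    simp only [Nat.sub_self, pow_zero, sub_self, mul_zero, zero_mul, add_zero]
    refine Finset.sum_congr rfl fun i hi => ?_
    rw [pfCoeff_succ_left hq (by have := Finset.mem_range.1 hi; omega)]
  · rw [Finset.sum_range_succ']
    simp only [pow_zero, sub_self, mul_zero, zero_mul, add_zero]
    refine Finset.sum_congr rfl fun i hi => ?_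
    rw [pfCoeff_succ_succ hq, inv_pow]
    have := pow_ne_zero (i + 1) hq0
    field_simp

/-- The finite `q`-binomial theorem. -/
theorem sum_pfCoeff_mul_pow {q : ℂ} (hq : ‖q‖ < 1) (y : ℂ) (N : ℕ) :
    ∑ i ∈ Finset.range (N + 1), pfCoeff q N i * y ^ i = qPoch (y * q) q N / qPoch q q N := by
  induction N with
  | zero => simp [pfCoeff, qPoch]
  | succ N ih =>
    have h := sum_pfCoeff_succ hq N (fun i => y ^ i)
    have h3 := one_sub_pow_ne_zero hq N
    have h2 := qPoch_self_ne_zero hq N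
    simp only [pow_succ y, ← mul_assoc, ← Finset.sum_mul] at h
    rw [ih] at h
    apply mul_left_cancel₀ h3
    rw [h, qPoch_succ, qPoch_self_succ]
    field_simp
    ring

theorem qPoch_succ_ne_zero_shift {x q : ℂ} {N : ℕ} (h : ∀ i ≤ N + 1, 1 - x * q ^ i ≠ 0) :
    ∀ i ≤ N, 1 - x * q * q ^ i ≠ 0 := fun i hi => by
  rw [mul_assoc, ← pow_succ']; exact h (i + 1) (by omega)

/-- Partial fraction decomposition of `x ^ k / (x;q)_{N+1}`. -/
theorem sum_pfCoeff_div {q : ℂ} (hq : ‖q‖ < 1) (hq0 : q ≠ 0) (k m : ℕ) : ∀ (x : ℂ),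
    (∀ i ≤ k + m, 1 - x * q ^ i ≠ 0) →
    ∑ i ∈ Finset.range (k + m + 1), pfCoeff q (k + m) i * (q⁻¹ ^ (k * i) / (1 - x * q ^ i)) =
      x ^ k / qPoch x q (k + m + 1) := by
  have arg : ∀ (N : ℕ) (x : ℂ), (∀ i ≤ N + 1, 1 - x * q ^ i ≠ 0) →
      1 - x ≠ 0 ∧ 1 - x * q ^ (N + 1) ≠ 0 ∧ qPoch x q (N + 1) ≠ 0 ∧
        qPoch (x * q) q (N + 1) = qPoch x q (N + 1) * (1 - x * q ^ (N + 1)) / (1 - x) := by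
    intro N x hx
    have h0 : 1 - x ≠ 0 := by simpa using hx 0 (by omega)
    refine ⟨h0, hx _ le_rfl, qPoch_ne_zero fun j hj => hx j (by omega), ?_⟩
    rw [← qPoch_succ, qPoch_succ' x q (N + 1)]
    field_simp
  -- The base case `m = 0` is an induction on `k` that raises the number of factors and the power of
  -- `x` together; the step in `m` raises only the former. The shift `h (i + 1)` replaces `x` by `x
  -- q`, so `x` must stay general.
  induction m with
  | zero =>
    induction k with
    | zero => intro x hx; simp [pfCoeff, qPoch]
    | succ k ih =>
      intro x hx
      simp only [add_zero] at ih hx ⊢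
      have h := sum_pfCoeff_inv_pow_succ hq hq0 k (fun i => q⁻¹ ^ (k * i) / (1 - x * q ^ i))
      have h3 := one_sub_pow_ne_zero hq k
      have e1 : ∀ i, q⁻¹ ^ (k * (i + 1)) / (1 - x * q ^ (i + 1)) =
          q⁻¹ ^ k * (q⁻¹ ^ (k * i) / (1 - x * q * q ^ i)) := fun i => by
        rw [mul_add, pow_add, mul_one, pow_succ']; ring
      simp only [e1, mul_left_comm _ (q⁻¹ ^ k), ← Finset.mul_sum] at h
      rw [ih x fun i hi => hx i (by omega), ih (x * q) (qPoch_succ_ne_zero_shift hx)] at h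
      obtain ⟨a1, a2, a3, a4⟩ := arg k x hx
      rw [a4] at h
      apply mul_left_cancel₀ h3
      have e2 : ∀ i, q⁻¹ ^ ((k + 1) * i) / (1 - x * q ^ i) =
          q⁻¹ ^ i * (q⁻¹ ^ (k * i) / (1 - x * q ^ i)) := fun i => by
        rw [add_mul, pow_add, one_mul]; ring
      simp only [e2]
      rw [h, qPoch_succ x q (k + 1), mul_pow, inv_pow]
      have := pow_ne_zero k hq0
      field_simp
      ring
  | succ m ih =>
    intro x hx
    have h := sum_pfCoeff_succ hq (k + m) (fun i => q⁻¹ ^ (k * i) / (1 - x * q ^ i))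
    have h3 := one_sub_pow_ne_zero hq (k + m)
    have e1 : ∀ i, q⁻¹ ^ (k * (i + 1)) / (1 - x * q ^ (i + 1)) =
        q⁻¹ ^ k * (q⁻¹ ^ (k * i) / (1 - x * q * q ^ i)) := fun i => by
      rw [mul_add, pow_add, mul_one, pow_succ']; ring
    simp only [e1, mul_left_comm _ (q⁻¹ ^ k), ← Finset.mul_sum] at h
    rw [ih x fun i hi => hx i (by omega), ih (x * q) (qPoch_succ_ne_zero_shift hx)] at h
    obtain ⟨a1, a2, a3, a4⟩ := arg (k + m) x hx
    rw [a4] at h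
    apply mul_left_cancel₀ h3
    rw [← add_assoc, h, qPoch_succ x q (k + m + 1), mul_pow, inv_pow]
    have := pow_ne_zero k hq0
    generalize q ^ (k + m + 1) = Q at *
    obtain ⟨R, hR⟩ : ∃ R, R = 1 - x * Q := ⟨_, rfl⟩
    rw [← hR] at a2 ⊢
    field_simp
    rw [hR]
    ring

/-! ### Infinite products and Cauchy's sum -/

theorem tendsto_qPoch (a : ℂ) {q : ℂ} (hq : ‖q‖ < 1) :
    Tendsto (qPoch a q) atTop (𝓝 (qPochInf a q)) :=
  (multipliable_qPochInf a hq).tendsto_prod_tprod_nat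

theorem qPochInf_ne_zero {a q : ℂ} (hq : ‖q‖ < 1) (h : ∀ j, 1 - a * q ^ j ≠ 0) :
    qPochInf a q ≠ 0 := by
  have hs : Summable fun j : ℕ => ‖-(a * q ^ j)‖ := by
    simpa using (summable_geometric_of_lt_one (norm_nonneg q) hq).mul_left ‖a‖
  have := tprod_one_add_ne_zero_of_summable (f := fun j : ℕ => -(a * q ^ j))
    (by simpa [← sub_eq_add_neg] using h) hs
  simpa [qPochInf, ← sub_eq_add_neg] using this

theorem qPochInf_self_ne_zero {q : ℂ} (hq : ‖q‖ < 1) : qPochInf q q ≠ 0 :=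
  qPochInf_ne_zero hq fun j => by simpa [pow_succ'] using one_sub_pow_ne_zero hq j

theorem qPochInf_eq_mul (a : ℂ) {q : ℂ} (hq : ‖q‖ < 1) :
    qPochInf a q = (1 - a) * qPochInf (a * q) q := by
  have h := tendsto_nhds_unique ((tendsto_qPoch a hq).comp (tendsto_add_atTop_nat 1))
    (((tendsto_qPoch (a * q) hq).const_mul (1 - a)).congr fun n => (qPoch_succ' a q n).symm)
  exact h

theorem exists_norm_inv_qPoch_self_le {q : ℂ} (hq : ‖q‖ < 1) :
    ∃ C, 0 ≤ C ∧ ∀ n, ‖(qPoch q q n)⁻¹‖ ≤ C := by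
  obtain ⟨C, hC⟩ := ((tendsto_qPoch q hq).inv₀ (qPochInf_self_ne_zero hq)).norm.bddAbove_range
  have hC' : ∀ n, ‖(qPoch q q n)⁻¹‖ ≤ C := fun n => hC ⟨n, rfl⟩
  exact ⟨C, (norm_nonneg _).trans (hC' 0), hC'⟩

/-- The terms of Cauchy's sum for `1 / (q;q)_∞`. -/
noncomputable def cauchyTerm (q : ℂ) (k m : ℕ) : ℂ :=
  q ^ (m ^ 2 + k * m) / (qPoch q q m * qPoch q q (m + k))

theorem norm_cauchyTerm_le {q : ℂ} (hq : ‖q‖ < 1) {C : ℝ} (h0 : 0 ≤ C)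
    (hC : ∀ n, ‖(qPoch q q n)⁻¹‖ ≤ C) (k m : ℕ) : ‖cauchyTerm q k m‖ ≤ C ^ 2 * ‖q‖ ^ m := by
  rw [cauchyTerm, div_eq_mul_inv, mul_inv, norm_mul, norm_mul, norm_pow]
  have h1 : ‖q‖ ^ (m ^ 2 + k * m) ≤ ‖q‖ ^ m :=
    pow_le_pow_of_le_one (norm_nonneg q) hq.le (by nlinarith [Nat.le_self_pow two_ne_zero m])
  have h2 := mul_le_mul (hC m) (hC (m + k)) (norm_nonneg _) h0
  calc _ ≤ ‖q‖ ^ m * (C * C) := mul_le_mul h1 h2 (by positivity) (by positivity)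
    _ = _ := by ring

theorem summable_cauchyTerm {q : ℂ} (hq : ‖q‖ < 1) (k : ℕ) : Summable (cauchyTerm q k) := by
  obtain ⟨C, h0, hC⟩ := exists_norm_inv_qPoch_self_le hq
  exact .of_norm_bounded ((summable_geometric_of_lt_one (norm_nonneg q) hq).mul_left (C ^ 2))
    (norm_cauchyTerm_le hq h0 hC k)

/-- The auxiliary `u` has vanishing term at `m = 0`, and its shift by one is `q^{k+1}` times the
summand for `k + 2`. -/
theorem tsum_cauchyTerm_sub {q : ℂ} (hq : ‖q‖ < 1) (k : ℕ) :
    ∑' m, cauchyTerm q k m - ∑' m, cauchyTerm q (k + 1) m =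
      -(q ^ (k + 1) * (∑' m, cauchyTerm q (k + 1) m - ∑' m, cauchyTerm q (k + 2) m)) := by
  have hP := qPoch_self_ne_zero hq
  have hs := summable_cauchyTerm hq
  set u : ℕ → ℂ := fun m =>
    q ^ (m ^ 2 + k * m) * (1 - q ^ m) / (qPoch q q m * qPoch q q (m + k + 1)) with hu
  have hu0 : u 0 = 0 := by simp [hu]
  have hu1 : ∀ m, u (m + 1) = q ^ (k + 1) * cauchyTerm q (k + 2) m := by
    intro m
    simp only [hu, cauchyTerm]
    rw [qPoch_self_succ q m, show m + 1 + k + 1 = m + (k + 2) by ring]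
    have := one_sub_pow_ne_zero hq m
    have h1 := hP m
    have h2 := hP (m + (k + 2))
    field_simp
    ring
  have hu2 : ∀ m, cauchyTerm q k m - cauchyTerm q (k + 1) m =
      u m - q ^ (k + 1) * cauchyTerm q (k + 1) m := by
    intro m
    simp only [hu, cauchyTerm]
    rw [show m + (k + 1) = m + k + 1 by ring, qPoch_self_succ q (m + k)]
    have := one_sub_pow_ne_zero hq (m + k)
    have h1 := hP m
    have h2 := hP (m + k)
    field_simp
    ring
  have hus : Summable u := (summable_nat_add_iff 1).1 (by
    simpa only [hu1] using (hs (k + 2)).mul_left (q ^ (k + 1)))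
  rw [← (hs k).tsum_sub (hs (k + 1)), tsum_congr hu2, hus.tsum_sub ((hs (k + 1)).mul_left _),
    hus.tsum_eq_zero_add, hu0, tsum_congr hu1, tsum_mul_left, tsum_mul_left]
  ring

/-- Iterating `tsum_cauchyTerm_sub` bounds the difference of neighbouring values by `|q|^N` times a
later difference, hence by zero: the sum does not depend on `k`. As `k → ∞` only the term `m = 0`
survives, and it tends to `1 / (q;q)_∞`. -/
theorem tsum_cauchyTerm {q : ℂ} (hq : ‖q‖ < 1) (k : ℕ) :
    ∑' m, cauchyTerm q k m = (qPochInf q q)⁻¹ := by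
  obtain ⟨C, h0, hC⟩ := exists_norm_inv_qPoch_self_le hq
  have hg := (summable_geometric_of_lt_one (norm_nonneg q) hq).mul_left (C ^ 2)
  set f : ℕ → ℂ := fun k => ∑' m, cauchyTerm q k m with hf
  have hlim : Tendsto f atTop (𝓝 (qPochInf q q)⁻¹) := by
    have := tendsto_tsum_of_dominated_convergence (𝓕 := atTop) (f := cauchyTerm q)
      (g := fun m => if m = 0 then (qPochInf q q)⁻¹ else 0) hg ?_
      (Eventually.of_forall fun k m => norm_cauchyTerm_le hq h0 hC k m)
    · rwa [tsum_ite_eq] at this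
    · intro m
      rcases Nat.eq_zero_or_pos m with rfl | hm
      · simpa [cauchyTerm, qPoch_zero] using (tendsto_qPoch q hq).inv₀ (qPochInf_self_ne_zero hq)
      · rw [if_neg hm.ne']
        have h1 : Tendsto (fun k : ℕ => C ^ 2 * ‖q‖ ^ k) atTop (𝓝 0) := by
          simpa using (tendsto_pow_atTop_nhds_zero_of_lt_one (norm_nonneg q) hq).const_mul (C ^ 2)
        refine squeeze_zero_norm (fun k => ?_) h1
        rw [cauchyTerm, div_eq_mul_inv, mul_inv, norm_mul, norm_mul, norm_pow]
        have h1 : ‖q‖ ^ (m ^ 2 + k * m) ≤ ‖q‖ ^ k :=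
          pow_le_pow_of_le_one (norm_nonneg q) hq.le (by nlinarith)
        have h2 := mul_le_mul (hC m) (hC (m + k)) (norm_nonneg _) h0
        calc _ ≤ ‖q‖ ^ k * (C * C) := mul_le_mul h1 h2 (by positivity) (by positivity)
          _ = _ := by ring
  have hd : ∀ N k, ‖f k - f (k + 1)‖ ≤ ‖q‖ ^ N * ‖f (k + N) - f (k + N + 1)‖ := by
    intro N
    induction N with
    | zero => intro k; simp
    | succ N ih =>
      intro k
      refine (ih k).trans ?_
      rw [pow_succ, mul_assoc]
      refine mul_le_mul_of_nonneg_left ?_ (by positivity)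
      have h := tsum_cauchyTerm_sub hq (k + N)
      change f (k + N) - f (k + N + 1) = -(_ * (f (k + N + 1) - f (k + N + 1 + 1))) at h
      rw [h, norm_neg, norm_mul, norm_pow]
      refine mul_le_mul_of_nonneg_right ?_ (norm_nonneg _)
      simpa using pow_le_pow_of_le_one (norm_nonneg q) hq.le (show 1 ≤ k + N + 1 by omega)
  have hstep : ∀ k, f (k + 1) = f k := by
    intro k
    have h1 : Tendsto (fun N : ℕ => ‖q‖ ^ N * ‖f (k + N) - f (k + N + 1)‖) atTop (𝓝 0) := by
      have a := (hlim.comp (tendsto_add_atTop_nat k)).sub (hlim.comp (tendsto_add_atTop_nat (k + 1)))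
      have b := (tendsto_pow_atTop_nhds_zero_of_lt_one (norm_nonneg q) hq).mul a.norm
      rw [zero_mul] at b
      refine b.congr fun N => ?_
      simp only [Function.comp]
      rw [add_comm N k, show N + (k + 1) = k + N + 1 by ring]
    have h2 := ge_of_tendsto h1 (Eventually.of_forall fun N => hd N k)
    exact (sub_eq_zero.1 (norm_le_zero_iff.1 h2)).symm
  have hconst : ∀ N, f (k + N) = f k := fun N => by
    induction N with
    | zero => rfl
    | succ N ih => rw [← add_assoc, hstep, ih]
  refine tendsto_nhds_unique (f := fun N => f (N + k)) ?_ (hlim.comp (tendsto_add_atTop_nat k))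
  refine tendsto_const_nhds.congr fun N => ?_
  rw [add_comm, hconst]

/-! ### Bailey's lemma -/

theorem summable_pow_natAbs {s : ℝ} (h0 : 0 ≤ s) (h1 : s < 1) :
    Summable fun r : ℤ => s ^ r.natAbs :=
  .of_nat_of_neg (by simpa using summable_geometric_of_lt_one h0 h1)
    (by simpa using summable_geometric_of_lt_one h0 h1)

/-- Bailey's lemma with `a = 1` and both parameters at infinity. -/
theorem hasSum_bailey {q : ℂ} (hq : ‖q‖ < 1) (f : ℤ → ℂ) {M : ℝ} (hf : ∀ r, ‖f r‖ ≤ M) :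
    HasSum (fun n : ℕ => q ^ (n ^ 2) *
      ∑ i ∈ Finset.range (2 * n + 1), f (i - n) / (qPoch q q i * qPoch q q (2 * n - i)))
      ((∑' r : ℤ, q ^ (r.natAbs ^ 2) * f r) / qPochInf q q) := by
  obtain ⟨C, h0, hC⟩ := exists_norm_inv_qPoch_self_le hq
  have hM : 0 ≤ M := (norm_nonneg _).trans (hf 0)
  -- With `i = n + r`, summing `D` over `r` gives the inner finite sum, and summing over `n = m +
  -- |r|` gives Cauchy's sum for `k = 2|r|`. The theorem is the exchange of the two.
  set D : ℕ × ℤ → ℂ := fun p => if p.2.natAbs ≤ p.1 then q ^ (p.1 ^ 2) *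
    (f p.2 / (qPoch q q (p.1 + p.2).toNat * qPoch q q (p.1 - p.2).toNat)) else 0 with hD
  -- On the support `|r| ≤ n`, so `|q|^{n²} = s^{2n²} ≤ s^n s^{|r|}`, a summable product.
  set s := √‖q‖ with hs
  have hs0 : 0 ≤ s := Real.sqrt_nonneg _
  have hs1 : s < 1 := by rw [hs, Real.sqrt_lt' one_pos]; simpa using hq
  have hsq : ‖q‖ = s ^ 2 := (Real.sq_sqrt (norm_nonneg q)).symm
  have hDs : Summable D := by
    have hb := (((summable_geometric_of_lt_one hs0 hs1).mul_of_nonneg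
      (summable_pow_natAbs hs0 hs1) (fun n => by positivity)
      (fun r => by positivity)).mul_left (M * C ^ 2))
    refine .of_norm_bounded hb fun p => ?_
    obtain ⟨n, r⟩ := p
    simp only [hD]
    split_ifs with h
    · rw [norm_mul, div_eq_mul_inv, mul_inv, norm_mul, norm_mul, norm_pow, hsq, ← pow_mul, ← pow_add]
      have h1 : s ^ (2 * n ^ 2) ≤ s ^ (n + r.natAbs) :=
        pow_le_pow_of_le_one hs0 hs1.le (by nlinarith [Nat.le_self_pow two_ne_zero n])
      have h2 := mul_le_mul (hf r) (mul_le_mul (hC (n + r).toNat) (hC (n - r).toNat)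
        (norm_nonneg _) h0) (by positivity) hM
      calc _ ≤ s ^ (n + r.natAbs) * (M * (C * C)) := mul_le_mul h1 h2 (by positivity) (by positivity)
        _ = _ := by ring
    · rw [norm_zero]; positivity
  have hrow : ∀ r : ℤ, HasSum (fun n => D (n, r)) (q ^ (r.natAbs ^ 2) * f r * (qPochInf q q)⁻¹) := by
    intro r
    have hinj : Function.Injective fun m : ℕ => m + r.natAbs := add_left_injective _
    rw [← hinj.hasSum_iff]
    · have h := ((summable_cauchyTerm hq (2 * r.natAbs)).hasSum).mul_left (q ^ (r.natAbs ^ 2) * f r)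
      rw [tsum_cauchyTerm hq] at h
      convert! h using 1
      ext m
      simp only [hD, Function.comp, le_add_iff_nonneg_left, zero_le, if_true, cauchyTerm]
      have e1 : q ^ ((m + r.natAbs) ^ 2) = q ^ (r.natAbs ^ 2) * q ^ (m ^ 2 + 2 * r.natAbs * m) := by
        rw [← pow_add]; congr 1; ring
      rw [e1]
      rcases le_total 0 r with hr | hr
      · rw [show ((m + r.natAbs : ℕ) + r).toNat = m + 2 * r.natAbs by omega,
          show ((m + r.natAbs : ℕ) - r).toNat = m by omega]
        ring
      · rw [show ((m + r.natAbs : ℕ) + r).toNat = m by omega,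
          show ((m + r.natAbs : ℕ) - r).toNat = m + 2 * r.natAbs by omega]
        ring
    · intro n hn
      simp only [hD]
      rw [if_neg]
      intro h
      exact hn ⟨n - r.natAbs, Nat.sub_add_cancel h⟩
  have hcol : ∀ n : ℕ, HasSum (fun r => D (n, r)) (q ^ (n ^ 2) *
      ∑ i ∈ Finset.range (2 * n + 1), f (i - n) / (qPoch q q i * qPoch q q (2 * n - i))) := by
    intro n
    have hinj : Function.Injective fun i : ℕ => (i : ℤ) - n := fun a b h => by
      simpa using h
    have : q ^ (n ^ 2) * ∑ i ∈ Finset.range (2 * n + 1),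
        f (i - n) / (qPoch q q i * qPoch q q (2 * n - i)) =
        ∑ r ∈ (Finset.range (2 * n + 1)).map ⟨_, hinj⟩, D (n, r) := by
      rw [Finset.sum_map, Finset.mul_sum]
      refine Finset.sum_congr rfl fun i hi => ?_
      have hi := Finset.mem_range.1 hi
      simp only [hD, Function.Embedding.coeFn_mk]
      rw [if_pos (by omega), show ((n : ℤ) + (i - n)).toNat = i by omega,
        show ((n : ℤ) - (i - n)).toNat = 2 * n - i by omega]
    rw [this]
    refine hasSum_sum_of_ne_finset_zero fun r hr => ?_
    simp only [hD]
    rw [if_neg]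
    intro h
    refine hr (Finset.mem_map.2 ⟨(n + r).toNat, Finset.mem_range.2 (by omega), ?_⟩)
    simp only [Function.Embedding.coeFn_mk]
    omega
  have h1 := hDs.hasSum.prod_fiberwise hcol
  have h2 := ((Equiv.prodComm ℤ ℕ).hasSum_iff.2 hDs.hasSum).prod_fiberwise hrow
  rw [div_eq_mul_inv, ← tsum_mul_right, h2.tsum_eq]
  exact h1

/-! ### The exponential `e`: identities and bounds -/

theorem e_add (x y : ℂ) : e (x + y) = e x * e y := by
  rw [e, mul_add, Complex.exp_add, e, e]

theorem e_zero : e 0 = 1 := by simp [e]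

theorem e_ne_zero (x : ℂ) : e x ≠ 0 := Complex.exp_ne_zero _

theorem e_neg (x : ℂ) : e (-x) = (e x)⁻¹ := by
  rw [e, mul_neg, Complex.exp_neg, e]

theorem e_natCast_mul (n : ℕ) (x : ℂ) : e (n * x) = e x ^ n := by
  rw [e, e, ← Complex.exp_nat_mul]
  congr 1
  ring

theorem e_half_sq (x : ℂ) : e (x / 2) ^ 2 = e x := by
  rw [← e_natCast_mul]
  congr 1
  push_cast
  ring

theorem e_int (n : ℤ) : e n = 1 := by
  rw [e, ← Complex.exp_int_mul_two_pi_mul_I n]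
  congr 1
  ring

theorem e_half : e (1 / 2) = -1 := by
  rw [e, ← Complex.exp_pi_mul_I]
  congr 1
  ring

theorem e_eq_one_iff {x : ℂ} : e x = 1 ↔ ∃ n : ℤ, x = n := by
  constructor
  · intro h
    obtain ⟨n, hn⟩ := Complex.exp_eq_one_iff.1 h
    refine ⟨n, mul_left_cancel₀ Complex.two_pi_I_ne_zero (hn.trans (mul_comm _ _))⟩
  · rintro ⟨n, rfl⟩
    exact e_int n

theorem norm_e (x : ℂ) : ‖e x‖ = Real.exp (-(2 * Real.pi * x.im)) := by
  rw [e, Complex.norm_exp]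
  congr 1
  simp

theorem norm_e_lt_one {τ : ℂ} (hτ : 0 < τ.im) : ‖e τ‖ < 1 := by
  rw [norm_e, Real.exp_lt_one_iff]
  have := mul_pos Real.pi_pos hτ
  linarith

theorem norm_e_le_one {τ : ℂ} (hτ : 0 ≤ τ.im) : ‖e τ‖ ≤ 1 := by
  rw [norm_e, Real.exp_le_one_iff]
  have := mul_nonneg Real.pi_pos.le hτ
  linarith

theorem norm_e_le_half {x : ℂ} (hx : 1 ≤ x.im) : ‖e x‖ ≤ 1 / 2 := by
  rw [norm_e, Real.exp_neg, one_div]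
  refine inv_anti₀ two_pos ?_
  have h1 := Real.add_one_le_exp (2 * Real.pi * x.im)
  nlinarith [Real.pi_gt_three]

theorem two_le_norm_e {x : ℂ} (hx : x.im ≤ -1) : 2 ≤ ‖e x‖ := by
  have h := norm_e_le_half (x := -x) (by simpa using by linarith)
  rw [e_neg, norm_inv, one_div] at h
  exact (inv_le_inv₀ (norm_pos_iff.2 (e_ne_zero x)) two_pos).1 h

/-- For such `n` the imaginary part of `z + nt` is at least `1` in absolute value. This keeps `e`
away from the pole `1` of the kernels, uniformly in `z` and `t`. -/
theorem norm_e_add_int_mul {Y T : ℝ} {z t : ℂ} (hz : |z.im| ≤ Y) (ht : T ≤ t.im)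
    {n : ℤ} (hn : Y + 1 ≤ T * |(n : ℝ)|) :
    ‖e (z + n * t)‖ ≤ 1 / 2 ∨ 2 ≤ ‖e (z + n * t)‖ := by
  have him : (z + n * t).im = z.im + n * t.im := by simp
  have hz := abs_le.1 hz
  rcases le_total 0 (n : ℝ) with h | h
  · left
    rw [abs_of_nonneg h] at hn
    exact norm_e_le_half (by rw [him]; nlinarith [mul_le_mul_of_nonneg_left ht h])
  · right
    rw [abs_of_nonpos h] at hn
    exact two_le_norm_e (by rw [him]; nlinarith [mul_le_mul_of_nonpos_left ht h])

theorem exists_norm_le_of_forall_large {E : Type*} [SeminormedAddCommGroup E] {f : ℤ → E} {N B : ℝ}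
    (h : ∀ n : ℤ, N ≤ |(n : ℝ)| → ‖f n‖ ≤ B) : ∃ M, ∀ n, ‖f n‖ ≤ M := by
  refine ⟨|B| + ∑ n ∈ Finset.Icc (-⌈N⌉) ⌈N⌉, ‖f n‖, fun n => ?_⟩
  by_cases hn : N ≤ |(n : ℝ)|
  · exact ((h n hn).trans (le_abs_self B)).trans
      (le_add_of_nonneg_right (Finset.sum_nonneg fun _ _ => norm_nonneg _))
  · have hmem : n ∈ Finset.Icc (-⌈N⌉) ⌈N⌉ := by
      have h1 : |(n : ℝ)| ≤ ⌈N⌉ := (not_le.1 hn).le.trans (Int.le_ceil N)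
      rw [← Int.cast_abs] at h1
      exact Finset.mem_Icc.2 (abs_le.1 (by exact_mod_cast h1))
    exact (Finset.single_le_sum (f := fun n => ‖f n‖) (fun _ _ => norm_nonneg _) hmem).trans
      (le_add_of_nonneg_left (abs_nonneg B))

theorem norm_neg_one_zpow (n : ℤ) : ‖(-1 : ℂ) ^ n‖ = 1 := by simp [norm_zpow]

theorem int_mul_add_one_nonneg (r : ℤ) : 0 ≤ (r : ℝ) * (r + 1) / 2 := by
  have h : 0 ≤ r * (r + 1) := by rcases le_or_gt 0 r with h | h <;> nlinarith
  have : (0 : ℝ) ≤ r * (r + 1) := by exact_mod_cast h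
  linarith

theorem norm_e_triangular_le {τ : ℂ} (hτ : 0 < τ.im) (r : ℤ) :
    ‖e (τ * (r * (r + 1) / 2))‖ ≤ 1 := by
  refine norm_e_le_one ?_
  have : (τ * ((r : ℂ) * (r + 1) / 2)) = ((((r : ℝ) * (r + 1) / 2 : ℝ)) : ℂ) * τ := by
    push_cast; ring
  rw [this, Complex.im_ofReal_mul]
  exact mul_nonneg (int_mul_add_one_nonneg r) hτ.le

/-! ### The rank series as a bilateral sum, and the pentagonal number theorem -/

theorem qPoch_add (a q : ℂ) (m n : ℕ) : qPoch a q (m + n) = qPoch a q m * qPoch (a * q ^ m) q n := by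
  simp only [qPoch, Finset.prod_range_add, pow_add, mul_assoc]

/-- Factor by factor, `1 - ζq^{-k} = -ζq^{-k} (1 - ζ⁻¹q^k)` for `k = 1, …, n`. -/
theorem qPoch_reflect (z τ : ℂ) (n : ℕ) : qPoch (e (z - n * τ)) (e τ) n =
    (-1) ^ n * e (n * z - τ * (n * (n + 1) / 2)) * qPoch ((e z)⁻¹ * e τ) (e τ) n := by
  induction n with
  | zero => simp [qPoch, e_zero]
  | succ n ih =>
    rw [qPoch_succ', ← e_add, show z - ((n + 1 : ℕ) : ℂ) * τ + τ = z - n * τ by push_cast; ring, ih,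
      qPoch_succ, ← e_neg, ← e_add, ← e_natCast_mul, ← e_add]
    have h : e (-z + τ + n * τ) * e (z - (n + 1 : ℕ) * τ) = 1 := by
      rw [← e_add, ← e_zero]; congr 1; push_cast; ring
    have h2 : e ((n + 1 : ℕ) * z - τ * ((n + 1 : ℕ) * ((n + 1 : ℕ) + 1) / 2)) =
        e (n * z - τ * (n * (n + 1) / 2)) * e (z - (n + 1 : ℕ) * τ) := by
      rw [← e_add]; congr 1; push_cast; ring
    rw [h2, pow_succ]
    linear_combination (-(-1) ^ n * e (n * z - τ * (n * (n + 1) / 2)) *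
      qPoch (e (-z + τ)) (e τ) n) * h

theorem pow_choose_two (τ : ℂ) (i : ℕ) : e τ ^ ((i + 1).choose 2) = e (τ * (i * (i + 1) / 2)) := by
  rw [← e_natCast_mul, Nat.cast_choose_two]
  congr 1
  push_cast
  ring

/-- Puts the summand in the form required by `hasSum_bailey`. The product `(ζq^{-n};q)_{2n+1}`
splits as `(ζq^{-n};q)_n (1 - ζ) (ζq;q)_n`, and reflecting the first factor produces the rank
denominator; partial fractions in `x = ζq^{-n}` do the rest. -/
theorem rankTerm_eq_sum {z τ : ℂ} (hτ : 0 < τ.im) (hz : ∀ n : ℤ, e (z + n * τ) ≠ 1) (n : ℕ) :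
    rankTerm (e z) (e τ) n = e τ ^ (n ^ 2) * ∑ i ∈ Finset.range (2 * n + 1),
      ((1 - e z) * ((-1) ^ ((i : ℤ) - n) * e (τ * (((i : ℤ) - n : ℤ) * (((i : ℤ) - n : ℤ) + 1) / 2)) /
        (1 - e (z + ((i : ℤ) - n : ℤ) * τ)))) /
        (qPoch (e τ) (e τ) i * qPoch (e τ) (e τ) (2 * n - i)) := by
  have hq := norm_e_lt_one hτ
  have hfac : ∀ i : ℕ, e (z - n * τ) * e τ ^ i = e (z + ((i : ℤ) - n : ℤ) * τ) := fun i => by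
    rw [← e_natCast_mul, ← e_add]; congr 1; push_cast; ring
  have h := sum_pfCoeff_div hq (e_ne_zero τ) n n (e (z - n * τ))
    fun i _ => by rw [hfac]; exact sub_ne_zero.2 (hz _).symm
  rw [← two_mul] at h
  have hz0 : 1 - e z ≠ 0 := sub_ne_zero.2 (by simpa using (hz 0).symm)
  have hterm : ∀ i ∈ Finset.range (2 * n + 1),
      ((1 - e z) * ((-1) ^ ((i : ℤ) - n) * e (τ * (((i : ℤ) - n : ℤ) * (((i : ℤ) - n : ℤ) + 1) / 2)) /
        (1 - e (z + ((i : ℤ) - n : ℤ) * τ)))) /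
        (qPoch (e τ) (e τ) i * qPoch (e τ) (e τ) (2 * n - i)) =
      (1 - e z) * (-1) ^ n * e (τ * ((n ^ 2 - n) / 2)) * (pfCoeff (e τ) (2 * n) i *
        ((e τ)⁻¹ ^ (n * i) / (1 - e (z - n * τ) * e τ ^ i))) := by
    intro i _
    rw [hfac, pfCoeff, pow_choose_two, ← e_neg, ← e_natCast_mul]
    have e1 : e (τ * (((i : ℤ) - n : ℤ) * (((i : ℤ) - n : ℤ) + 1) / 2)) =
        e (τ * ((n ^ 2 - n) / 2)) * e (τ * (i * (i + 1) / 2)) * e ((n * i : ℕ) * -τ) := by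
      rw [← e_add, ← e_add]; congr 1; push_cast; ring
    have e2 : (-1 : ℂ) ^ ((i : ℤ) - n) = (-1) ^ n * (-1) ^ i := by
      rw [zpow_sub₀ (by norm_num), zpow_natCast, zpow_natCast, div_eq_mul_inv, ← inv_pow,
        inv_neg_one, mul_comm]
    rw [e1, e2]
    ring
  rw [Finset.sum_congr rfl hterm, ← Finset.mul_sum, h, show 2 * n + 1 = n + (n + 1) by ring,
    qPoch_add, qPoch_reflect, hfac, qPoch_succ', rankTerm]
  simp only [sub_self, Int.cast_zero, zero_mul, add_zero]
  have e3 : e (τ * ((n ^ 2 - n) / 2)) * e (z - n * τ) ^ n = e (n * z - τ * (n * (n + 1) / 2)) := by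
    rw [← e_natCast_mul, ← e_add]; congr 1; ring
  have h1 := e_ne_zero (τ * ((n ^ 2 - n) / 2))
  have h2 := pow_ne_zero n (e_ne_zero (z - n * τ))
  have h3 : (-1 : ℂ) ^ n ≠ 0 := pow_ne_zero _ (by norm_num)
  rw [← e3]
  generalize e (τ * ((n ^ 2 - n) / 2)) = E at h1 ⊢
  generalize e (z - n * τ) ^ n = X at h2 ⊢
  field_simp

theorem pow_natAbs_sq (τ : ℂ) (r : ℤ) : e τ ^ (r.natAbs ^ 2) = e (r ^ 2 * τ) := by
  rw [← e_natCast_mul]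
  congr 2
  rw [Nat.cast_pow, Nat.cast_natAbs, ← Int.cast_pow, sq_abs, Int.cast_pow]

theorem hasSum_rankTerm {z τ : ℂ} (hτ : 0 < τ.im) (hz : ∀ n : ℤ, e (z + n * τ) ≠ 1) :
    HasSum (rankTerm (e z) (e τ)) ((∑' r : ℤ, e (r ^ 2 * τ) * ((1 - e z) * ((-1) ^ r *
      e (τ * (r * (r + 1) / 2)) / (1 - e (z + r * τ))))) / qPochInf (e τ) (e τ)) := by
  have hb : ∀ n : ℤ, (|z.im| + 1) / τ.im ≤ |(n : ℝ)| → ‖(1 - e z) * ((-1) ^ n *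
      e (τ * (n * (n + 1) / 2)) / (1 - e (z + n * τ)))‖ ≤ ‖1 - e z‖ * 2 := by
    intro n hn
    rw [div_le_iff₀ hτ] at hn
    rw [norm_mul, norm_div, norm_mul, norm_neg_one_zpow, one_mul, div_eq_mul_inv]
    refine mul_le_mul_of_nonneg_left ?_ (norm_nonneg _)
    rw [← one_mul (2 : ℝ)]
    refine mul_le_mul (norm_e_triangular_le hτ n) ?_ (by positivity) zero_le_one
    rw [← inv_inv (2 : ℝ)]
    refine inv_anti₀ (by norm_num) ?_
    rcases norm_e_add_int_mul (z := z) le_rfl le_rfl (n := n) (by linarith) with h | h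
    · have := norm_sub_norm_le 1 (e (z + n * τ))
      rw [norm_one] at this
      linarith
    · have := norm_sub_norm_le (e (z + n * τ)) 1
      rw [norm_one, norm_sub_rev] at this
      linarith
  obtain ⟨M, hM⟩ := exists_norm_le_of_forall_large hb
  have := hasSum_bailey (norm_e_lt_one hτ) _ hM
  simp only [pow_natAbs_sq] at this
  convert! this using 1
  ext n
  exact rankTerm_eq_sum hτ hz n

/-- Euler's pentagonal number theorem. -/
theorem tsum_pentagonal {τ : ℂ} (hτ : 0 < τ.im) :
    ∑' r : ℤ, e (r ^ 2 * τ) * ((-1) ^ r * e (τ * (r * (r - 1) / 2))) = qPochInf (e τ) (e τ) := by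
  have hq := norm_e_lt_one hτ
  have h := hasSum_bailey hq (fun r : ℤ => (-1) ^ r * e (τ * (r * (r - 1) / 2))) (M := 1) ?_
  · simp only [pow_natAbs_sq] at h
    -- For `n ≥ 1` the inner sum is a multiple of `(q^{-n};q)_{2n}`, which contains the factor `1 -
    -- q^0`; only `n = 0` survives.
    have h1 : HasSum (fun n : ℕ => e τ ^ (n ^ 2) * ∑ i ∈ Finset.range (2 * n + 1),
        ((-1) ^ ((i : ℤ) - n) * e (τ * (((i : ℤ) - n : ℤ) * (((i : ℤ) - n : ℤ) - 1) / 2))) /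
        (qPoch (e τ) (e τ) i * qPoch (e τ) (e τ) (2 * n - i))) 1 := by
      convert! hasSum_ite_eq (0 : ℕ) (1 : ℂ) using 1
      ext n
      have hterm : ∀ i ∈ Finset.range (2 * n + 1),
          ((-1) ^ ((i : ℤ) - n) * e (τ * (((i : ℤ) - n : ℤ) * (((i : ℤ) - n : ℤ) - 1) / 2))) /
          (qPoch (e τ) (e τ) i * qPoch (e τ) (e τ) (2 * n - i)) =
          (-1) ^ n * e (τ * ((n ^ 2 + n) / 2)) *
            (pfCoeff (e τ) (2 * n) i * e (-(n + 1) * τ) ^ i) := by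
        intro i _
        rw [pfCoeff, pow_choose_two, ← e_natCast_mul]
        have e1 : e (τ * (((i : ℤ) - n : ℤ) * (((i : ℤ) - n : ℤ) - 1) / 2)) =
            e (τ * ((n ^ 2 + n) / 2)) * e (τ * (i * (i + 1) / 2)) * e (i * (-(n + 1) * τ)) := by
          rw [← e_add, ← e_add]; congr 1; push_cast; ring
        have e2 : (-1 : ℂ) ^ ((i : ℤ) - n) = (-1) ^ n * (-1) ^ i := by
          rw [zpow_sub₀ (by norm_num), zpow_natCast, zpow_natCast, div_eq_mul_inv, ← inv_pow,
            inv_neg_one, mul_comm]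
        rw [e1, e2]
        ring
      rw [Finset.sum_congr rfl hterm, ← Finset.mul_sum, sum_pfCoeff_mul_pow hq]
      split_ifs with hn
      · subst hn; simp [qPoch, e_zero]
      · have : qPoch (e (-(n + 1) * τ) * e τ) (e τ) (2 * n) = 0 := by
          refine Finset.prod_eq_zero (Finset.mem_range.2 (show n < 2 * n by omega)) ?_
          rw [← e_natCast_mul, ← e_add, ← e_add, show -((n : ℂ) + 1) * τ + τ + n * τ = 0 by ring,
            e_zero, sub_self]
        rw [this]
        simp
    have h2 := h.unique h1
    rwa [div_eq_one_iff_eq (qPochInf_self_ne_zero hq)] at h2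
  · intro r
    rw [norm_mul, norm_neg_one_zpow, one_mul]
    have := norm_e_triangular_le hτ (r - 1)
    rw [show τ * (((r - 1 : ℤ) : ℂ) * (((r - 1 : ℤ) : ℂ) + 1) / 2) = τ * (r * (r - 1) / 2) by
      push_cast; ring] at this
    exact this

/-! ### The kernel `lerch` and its derivatives -/

theorem hasDerivAt_e (x : ℂ) : HasDerivAt e (2 * Real.pi * Complex.I * e x) x := by
  have h := ((hasDerivAt_id x).const_mul (2 * Real.pi * Complex.I)).cexp
  simp only [id, mul_one] at h
  rw [mul_comm]
  exact h

theorem differentiable_e : Differentiable ℂ e := fun x => (hasDerivAt_e x).differentiableAt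

@[fun_prop]
theorem continuous_e : Continuous e := differentiable_e.continuous

/-- The function `ζ^{1/2} / (1 - ζ)`. -/
noncomputable def lerch (w : ℂ) : ℂ := e (w / 2) / (1 - e w)

/-- The normalized derivative of `lerch`. -/
noncomputable def lerchD (w : ℂ) : ℂ := e (w / 2) * (1 + e w) / (2 * (1 - e w) ^ 2)

/-- The second normalized derivative of `lerch`. -/
noncomputable def lerchDD (w : ℂ) : ℂ := e (w / 2) * (1 + 6 * e w + e w ^ 2) / (4 * (1 - e w) ^ 3)

theorem hasDerivAt_e_half (w : ℂ) :
    HasDerivAt (fun w => e (w / 2)) (2 * Real.pi * Complex.I * (e (w / 2) / 2)) w := by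
  have h := (hasDerivAt_e (w / 2)).comp w ((hasDerivAt_id w).div_const 2)
  simp only [id] at h
  convert! h using 1
  ring

theorem hasDerivAt_lerch {w : ℂ} (hw : e w ≠ 1) :
    HasDerivAt lerch (2 * Real.pi * Complex.I * lerchD w) w := by
  have h1 : 1 - e w ≠ 0 := sub_ne_zero.2 hw.symm
  convert! (hasDerivAt_e_half w).div ((hasDerivAt_e w).const_sub 1) h1 using 1
  simp only [lerchD]
  field_simp
  ring

theorem hasDerivAt_lerchD {w : ℂ} (hw : e w ≠ 1) :
    HasDerivAt lerchD (2 * Real.pi * Complex.I * lerchDD w) w := by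
  have h1 : 1 - e w ≠ 0 := sub_ne_zero.2 hw.symm
  have h2 : 2 * (1 - e w) ^ 2 ≠ 0 := mul_ne_zero two_ne_zero (pow_ne_zero _ h1)
  convert! ((hasDerivAt_e_half w).mul ((hasDerivAt_e w).const_add 1)).div
    ((((hasDerivAt_e w).const_sub 1).pow 2).const_mul 2) h2 using 1
  simp only [lerchDD, Pi.mul_apply, Pi.pow_apply]
  field_simp
  ring

/-- The kernel is `i / (2 sin πw)`, and this is the differential equation of the cosecant. The
coefficient of the cube becomes the `2` of the PDE. -/
theorem lerchDD_eq {w : ℂ} (hw : e w ≠ 1) : lerchDD w = lerch w / 4 + 2 * lerch w ^ 3 := by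
  have h1 : 1 - e w ≠ 0 := sub_ne_zero.2 hw.symm
  rw [lerchDD, lerch, div_pow, pow_succ (e (w / 2)) 2, e_half_sq]
  field_simp
  ring

theorem e_neg_ne_one {w : ℂ} (hw : e w ≠ 1) : e (-w) ≠ 1 := by
  rwa [e_neg, ne_eq, inv_eq_one]

theorem lerch_neg (w : ℂ) : lerch (-w) = -lerch w := by
  -- At a pole both sides are `0`, by division by zero.
  by_cases hw : e w = 1
  · simp [lerch, e_neg, hw]
  have h1 : 1 - e w ≠ 0 := sub_ne_zero.2 (Ne.symm hw)
  have h2 : e w - 1 ≠ 0 := sub_ne_zero.2 hw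
  have h3 := e_ne_zero (w / 2)
  rw [lerch, lerch, neg_div, e_neg, e_neg]
  rw [← e_half_sq w] at h1 h2 ⊢
  generalize e (w / 2) = x at h1 h2 h3 ⊢
  have h4 : 1 - (x ^ 2)⁻¹ = (x ^ 2 - 1) / x ^ 2 := by field_simp
  have h5 : 1 - x ^ 2 = -(x ^ 2 - 1) := by ring
  rw [h4, h5, div_neg, neg_neg]
  field_simp

theorem lerchD_neg (w : ℂ) : lerchD (-w) = lerchD w := by
  by_cases hw : e w = 1
  · simp [lerchD, e_neg, hw]
  have h1 : 1 - e w ≠ 0 := sub_ne_zero.2 (Ne.symm hw)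
  have h2 : e w - 1 ≠ 0 := sub_ne_zero.2 hw
  have h3 := e_ne_zero (w / 2)
  rw [lerchD, lerchD, neg_div, e_neg, e_neg]
  rw [← e_half_sq w] at h1 h2 ⊢
  generalize e (w / 2) = x at h1 h2 h3 ⊢
  have h4 : 1 - (x ^ 2)⁻¹ = (x ^ 2 - 1) / x ^ 2 := by field_simp
  have h5 : (1 - x ^ 2) ^ 2 = (x ^ 2 - 1) ^ 2 := by ring
  rw [h4, h5]
  field_simp
  ring

theorem lerchDD_neg (w : ℂ) : lerchDD (-w) = -lerchDD w := by
  by_cases hw : e w = 1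
  · simp [lerchDD, e_neg, hw]
  rw [lerchDD_eq hw, lerchDD_eq (e_neg_ne_one hw), lerch_neg]
  ring

/-- The constant is dictated by `lerchDD`: numerator at most `8`, denominator contributing `2³/4`.
-/
theorem norm_lerch_le_of_le_half {w : ℂ} (hw : ‖e w‖ ≤ 1 / 2) :
    ‖lerch w‖ ≤ 16 ∧ ‖lerchD w‖ ≤ 16 ∧ ‖lerchDD w‖ ≤ 16 := by
  have h1 : ‖(1 - e w)⁻¹‖ ≤ 2 := by
    rw [norm_inv, ← inv_inv (2 : ℝ)]
    refine inv_anti₀ (by norm_num) ?_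
    have := norm_sub_norm_le 1 (e w)
    rw [norm_one] at this
    linarith
  have h2 : ‖e (w / 2)‖ ≤ 1 := by
    have : ‖e (w / 2)‖ ^ 2 = ‖e w‖ := by rw [← norm_pow, e_half_sq]
    nlinarith [norm_nonneg (e (w / 2))]
  have h3 : ‖1 + e w‖ ≤ 2 := (norm_add_le _ _).trans (by rw [norm_one]; linarith)
  have h4 : ‖1 + 6 * e w + e w ^ 2‖ ≤ 8 := by
    refine (norm_add₃_le).trans ?_
    rw [norm_one, norm_mul, norm_pow]
    have : ‖(6 : ℂ)‖ = 6 := by simp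
    nlinarith [norm_nonneg (e w)]
  have n2 : ‖(2 : ℂ)⁻¹‖ ≤ 1 := by norm_num
  have n4 : ‖(4 : ℂ)⁻¹‖ ≤ 1 / 4 := by norm_num
  refine ⟨?_, ?_, ?_⟩
  · rw [lerch, div_eq_mul_inv, norm_mul]
    calc _ ≤ (1 : ℝ) * 2 := by gcongr
      _ ≤ 16 := by norm_num
  · rw [lerchD, div_eq_mul_inv, mul_inv, ← inv_pow, norm_mul, norm_mul, norm_mul, norm_pow]
    calc _ ≤ (1 : ℝ) * 2 * (1 * 2 ^ 2) := by gcongr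
      _ ≤ 16 := by norm_num
  · rw [lerchDD, div_eq_mul_inv, mul_inv, ← inv_pow, norm_mul, norm_mul, norm_mul, norm_pow]
    calc _ ≤ (1 : ℝ) * 8 * (1 / 4 * 2 ^ 3) := by gcongr
      _ ≤ 16 := by norm_num

theorem norm_lerch_le {w : ℂ} (hw : ‖e w‖ ≤ 1 / 2 ∨ 2 ≤ ‖e w‖) :
    ‖lerch w‖ ≤ 16 ∧ ‖lerchD w‖ ≤ 16 ∧ ‖lerchDD w‖ ≤ 16 := by
  rcases hw with h | h
  · exact norm_lerch_le_of_le_half h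
  · have := norm_lerch_le_of_le_half (w := -w) (by
      rw [e_neg, norm_inv, one_div]; exact inv_anti₀ two_pos h)
    rwa [lerch_neg, lerchD_neg, lerchDD_neg, norm_neg, norm_neg] at this

/-! ### The Appell sum: convergence, regularity and heat operator -/

/-- The terms of the level three Appell sum. -/
noncomputable def appellTerm (z τ : ℂ) (n : ℤ) : ℂ :=
  (-1) ^ n * e (3 * n ^ 2 / 2 * τ) * lerch (z + n * τ)

/-- The normalized `z`-derivative of `appellTerm`. -/
noncomputable def appellTermD (z τ : ℂ) (n : ℤ) : ℂ :=
  (-1) ^ n * e (3 * n ^ 2 / 2 * τ) * lerchD (z + n * τ)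

/-- The image of `appellTerm` under the heat operator `6 𝒟_τ + 𝒟_z²`. -/
noncomputable def appellTermHeat (z τ : ℂ) (n : ℤ) : ℂ :=
  (-1) ^ n * e (3 * n ^ 2 / 2 * τ) *
    (9 * n ^ 2 * lerch (z + n * τ) + 6 * n * lerchD (z + n * τ) + lerchDD (z + n * τ))

theorem hasDerivAt_appellTerm {z τ : ℂ} {n : ℤ} (h : e (z + n * τ) ≠ 1) :
    HasDerivAt (fun x => appellTerm x τ n) (2 * Real.pi * Complex.I * appellTermD z τ n) z := by
  convert! ((hasDerivAt_lerch h).comp_add_const z (n * τ)).const_mul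
    ((-1) ^ n * e (3 * n ^ 2 / 2 * τ)) using 1
  rw [appellTermD]
  ring

theorem hasDerivAt_appellTermD {z τ : ℂ} {n : ℤ} (h : e (z + n * τ) ≠ 1) :
    HasDerivAt (fun x => appellTermD x τ n) (2 * Real.pi * Complex.I *
      ((-1) ^ n * e (3 * n ^ 2 / 2 * τ) * lerchDD (z + n * τ))) z := by
  convert! ((hasDerivAt_lerchD h).comp_add_const z (n * τ)).const_mul
    ((-1) ^ n * e (3 * n ^ 2 / 2 * τ)) using 1
  ring

theorem differentiableAt_appellTermHeat {z τ : ℂ} {n : ℤ} (h : e (z + n * τ) ≠ 1) :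
    DifferentiableAt ℂ (fun x => appellTermHeat x τ n) z := by
  have h1 := ((hasDerivAt_lerch h).comp_add_const z (n * τ)).differentiableAt
  have h2 := ((hasDerivAt_lerchD h).comp_add_const z (n * τ)).differentiableAt
  have h3 : DifferentiableAt ℂ (fun x => lerchDD (x + n * τ)) z := by
    have h1 : 4 * (1 - e (z + n * τ)) ^ 3 ≠ 0 :=
      mul_ne_zero (by norm_num) (pow_ne_zero _ (sub_ne_zero.2 h.symm))
    have d := differentiable_e
    unfold lerchDD
    fun_prop (disch := exact h1)
  unfold appellTermHeat
  fun_prop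

theorem hasDerivAt_e_const_mul (c τ : ℂ) :
    HasDerivAt (fun t => e (c * t)) (2 * Real.pi * Complex.I * (c * e (c * τ))) τ := by
  have h := (hasDerivAt_e (c * τ)).comp τ ((hasDerivAt_id τ).const_mul c)
  convert! h using 1
  ring

/-- The first summand comes from `q^{3n²/2}`, the second from `z + nτ` by the chain rule. Six times
this gives the first two summands of `appellTermHeat`. -/
theorem hasDerivAt_appellTerm_tau {z τ : ℂ} {n : ℤ} (h : e (z + n * τ) ≠ 1) :
    HasDerivAt (fun t => appellTerm z t n) (2 * Real.pi * Complex.I *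
      (3 * n ^ 2 / 2 * appellTerm z τ n + n * appellTermD z τ n)) τ := by
  have h1 : HasDerivAt (fun t => z + n * t) (n : ℂ) τ := by
    simpa using ((hasDerivAt_id τ).const_mul (n : ℂ)).const_add z
  convert! ((hasDerivAt_e_const_mul (3 * n ^ 2 / 2) τ).const_mul ((-1) ^ n)).mul
    (HasDerivAt.comp τ (hasDerivAt_lerch h) h1) using 1
  simp only [appellTerm, appellTermD, Function.comp]
  ring

theorem continuousAt_lerch {w : ℂ} (hw : e w ≠ 1) :
    ContinuousAt lerch w ∧ ContinuousAt lerchD w ∧ ContinuousAt lerchDD w := by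
  refine ⟨(hasDerivAt_lerch hw).continuousAt, (hasDerivAt_lerchD hw).continuousAt, ?_⟩
  have h1 : 4 * (1 - e w) ^ 3 ≠ 0 :=
    mul_ne_zero (by norm_num) (pow_ne_zero _ (sub_ne_zero.2 hw.symm))
  unfold lerchDD
  fun_prop (disch := exact h1)

theorem continuousAt_appellTerm {z τ : ℂ} {n : ℤ} (h : e (z + n * τ) ≠ 1) :
    ContinuousAt (fun p : ℂ × ℂ => appellTerm p.1 p.2 n) (z, τ) ∧
    ContinuousAt (fun p : ℂ × ℂ => appellTermD p.1 p.2 n) (z, τ) ∧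
    ContinuousAt (fun p : ℂ × ℂ => appellTermHeat p.1 p.2 n) (z, τ) := by
  obtain ⟨h1, h2, h3⟩ := continuousAt_lerch h
  have hl : ContinuousAt (fun p : ℂ × ℂ => p.1 + n * p.2) (z, τ) := by fun_prop
  have c1 : ContinuousAt (fun p : ℂ × ℂ => lerch (p.1 + n * p.2)) (z, τ) :=
    ContinuousAt.comp (g := lerch) h1 hl
  have c2 : ContinuousAt (fun p : ℂ × ℂ => lerchD (p.1 + n * p.2)) (z, τ) :=
    ContinuousAt.comp (g := lerchD) h2 hl
  have c3 : ContinuousAt (fun p : ℂ × ℂ => lerchDD (p.1 + n * p.2)) (z, τ) :=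
    ContinuousAt.comp (g := lerchDD) h3 hl
  refine ⟨?_, ?_, ?_⟩
  · unfold appellTerm; fun_prop
  · unfold appellTermD; fun_prop
  · unfold appellTermHeat; fun_prop

theorem norm_e_quadratic_le {T : ℝ} {t : ℂ} (ht : T ≤ t.im) (n : ℤ) :
    ‖e (3 * n ^ 2 / 2 * t)‖ ≤ Real.exp (-Real.pi * (3 * T * n ^ 2)) := by
  have : (3 * (n : ℂ) ^ 2 / 2 * t) = ((3 * (n : ℝ) ^ 2 / 2 : ℝ) : ℂ) * t := by push_cast; rfl
  rw [norm_e, this, Complex.im_ofReal_mul, Real.exp_le_exp]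
  have h := mul_le_mul_of_nonneg_left ht (mul_nonneg Real.pi_pos.le (sq_nonneg (n : ℝ)))
  nlinarith

/-- The kernels are at most `16`, the polynomial is the size of the heat coefficients, and the
quadratic exponent gives Gaussian decay. -/
theorem norm_appellTerm_le {Y T : ℝ} {z t : ℂ} (hz : |z.im| ≤ Y) (ht : T ≤ t.im) {n : ℤ}
    (hn : Y + 1 ≤ T * |(n : ℝ)|) :
    let b := 16 * (9 * |(n : ℝ)| ^ 2 + 6 * |(n : ℝ)| + 1) * Real.exp (-Real.pi * (3 * T * n ^ 2))
    ‖appellTerm z t n‖ ≤ b ∧ ‖appellTermD z t n‖ ≤ b ∧ ‖appellTermHeat z t n‖ ≤ b := by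
  intro b
  obtain ⟨h1, h2, h3⟩ := norm_lerch_le (norm_e_add_int_mul hz ht hn)
  have he := norm_e_quadratic_le ht n
  have hN : 0 ≤ |(n : ℝ)| := abs_nonneg _
  have hK : (16 : ℝ) ≤ 16 * (9 * |(n : ℝ)| ^ 2 + 6 * |(n : ℝ)| + 1) := by nlinarith
  have aux : ∀ {x : ℂ}, ‖x‖ ≤ 16 * (9 * |(n : ℝ)| ^ 2 + 6 * |(n : ℝ)| + 1) →
      ‖(-1) ^ n * e (3 * n ^ 2 / 2 * t) * x‖ ≤ b := by
    intro x hx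
    rw [norm_mul, norm_mul, norm_neg_one_zpow, one_mul, mul_comm]
    exact mul_le_mul hx he (norm_nonneg _) (by positivity)
  refine ⟨aux (h1.trans hK), aux (h2.trans hK), aux ?_⟩
  refine norm_add₃_le.trans ?_
  rw [norm_mul, norm_mul, norm_mul, norm_mul, norm_pow, Complex.norm_intCast]
  have n6 : ‖(6 : ℂ)‖ = 6 := by simp
  have n9 : ‖(9 : ℂ)‖ = 9 := by simp
  rw [n6, n9]
  calc _ ≤ 9 * |(n : ℝ)| ^ 2 * 16 + 6 * |(n : ℝ)| * 16 + 16 := by gcongr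
    _ = _ := by ring

theorem summable_appell_bound {T : ℝ} (hT : 0 < T) : Summable fun n : ℤ =>
    16 * (9 * |(n : ℝ)| ^ 2 + 6 * |(n : ℝ)| + 1) * Real.exp (-Real.pi * (3 * T * n ^ 2)) := by
  have h := fun k => summable_pow_mul_jacobiTheta₂_term_bound 0 (T := 3 * T) (by positivity) k
  have := (((h 2).mul_left 144).add ((h 1).mul_left 96)).add ((h 0).mul_left 16)
  refine this.congr fun n => ?_
  simp only [mul_zero, zero_mul, sub_zero, Int.cast_abs]
  ring

/-- Near a point `(z₀, τ₀)`, the terms of the Appell sum that have no pole there are bounded by a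
summable sequence, together with their derivatives. -/
theorem exists_appell_bound (z₀ : ℂ) {τ₀ : ℂ} (hτ : 0 < τ₀.im) :
    ∃ ε > 0, ∃ u : ℤ → ℝ, Summable u ∧ (∀ n, 0 ≤ u n) ∧
      ∀ z ∈ Metric.ball z₀ ε, ∀ t ∈ Metric.ball τ₀ ε, 0 < t.im ∧
      ∀ n : ℤ, e (z₀ + n * τ₀) ≠ 1 → e (z + n * t) ≠ 1 ∧ ‖appellTerm z t n‖ ≤ u n ∧
        ‖appellTermD z t n‖ ≤ u n ∧ ‖appellTermHeat z t n‖ ≤ u n := by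
  set T := τ₀.im / 2 with hTdef
  have hT : 0 < T := by positivity
  set Y := |z₀.im| + 1 with hY
  set N := (Y + 1) / T with hN
  set F := Finset.Icc (-⌈N⌉) ⌈N⌉ with hF
  -- For the finitely many `n` in `F` the bound is by continuity from the centre, whence the `+ 1`;
  -- for all other `n` the Gaussian bound `w` applies.
  set v : ℤ → ℝ := fun n =>
    ‖appellTerm z₀ τ₀ n‖ + ‖appellTermD z₀ τ₀ n‖ + ‖appellTermHeat z₀ τ₀ n‖ + 1 with hv
  have hv0 : ∀ n, 0 ≤ v n := fun n => by positivity
  set w : ℤ → ℝ := fun n =>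
    16 * (9 * |(n : ℝ)| ^ 2 + 6 * |(n : ℝ)| + 1) * Real.exp (-Real.pi * (3 * T * n ^ 2)) with hw
  have hw0 : ∀ n, 0 ≤ w n := fun n => by positivity
  have hfin : ∀ᶠ p : ℂ × ℂ in 𝓝 (z₀, τ₀), ∀ n ∈ F, e (z₀ + n * τ₀) ≠ 1 →
      e (p.1 + n * p.2) ≠ 1 ∧ ‖appellTerm p.1 p.2 n‖ ≤ v n ∧
        ‖appellTermD p.1 p.2 n‖ ≤ v n ∧ ‖appellTermHeat p.1 p.2 n‖ ≤ v n := by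
    refine (Filter.eventually_all_finset F).2 fun n _ => ?_
    by_cases hn : e (z₀ + n * τ₀) = 1
    · simp [hn]
    obtain ⟨c1, c2, c3⟩ := continuousAt_appellTerm hn
    have c0 : ContinuousAt (fun p : ℂ × ℂ => e (p.1 + n * p.2)) (z₀, τ₀) := by fun_prop
    have n1 := norm_nonneg (appellTerm z₀ τ₀ n)
    have n2 := norm_nonneg (appellTermD z₀ τ₀ n)
    have n3 := norm_nonneg (appellTermHeat z₀ τ₀ n)
    filter_upwards [c0.eventually_ne hn,
      c1.norm.eventually_lt_const (show _ < v n by simp only [hv]; linarith),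
      c2.norm.eventually_lt_const (show _ < v n by simp only [hv]; linarith),
      c3.norm.eventually_lt_const (show _ < v n by simp only [hv]; linarith)] with p p0 p1 p2 p3 _
    exact ⟨p0, p1.le, p2.le, p3.le⟩
  have him : ∀ᶠ p : ℂ × ℂ in 𝓝 (z₀, τ₀), |p.1.im| ≤ Y ∧ T ≤ p.2.im := by
    have c1 : ContinuousAt (fun p : ℂ × ℂ => |p.1.im|) (z₀, τ₀) := by fun_prop
    have c2 : ContinuousAt (fun p : ℂ × ℂ => p.2.im) (z₀, τ₀) := by fun_prop
    filter_upwards [c1.eventually_lt_const (show _ < Y by simp [hY]),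
      c2.eventually_const_lt (show T < _ by simp only [hTdef]; linarith)] with p p1 p2
    exact ⟨p1.le, p2.le⟩
  obtain ⟨ε, hε, hball⟩ := Metric.eventually_nhds_iff_ball.1 (hfin.and him)
  refine ⟨ε, hε, fun n => w n + if n ∈ F then v n else 0, ?_, ?_, ?_⟩
  · refine (summable_appell_bound hT).add (summable_of_ne_finset_zero (s := F) fun n hn => ?_)
    exact if_neg hn
  · intro n
    have := hw0 n
    have := hv0 n
    positivity
  intro z hz t ht
  obtain ⟨h1, h2, h3⟩ := hball (z, t) (by rw [← ball_prod_same]; exact ⟨hz, ht⟩)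
  refine ⟨hT.trans_le h3, fun n hn => ?_⟩
  by_cases hnF : n ∈ F
  · simp only [if_pos hnF]
    obtain ⟨a0, a1, a2, a3⟩ := h1 n hnF hn
    have := hw0 n
    exact ⟨a0, by linarith, by linarith, by linarith⟩
  · simp only [if_neg hnF, add_zero]
    have hlarge : Y + 1 ≤ T * |(n : ℝ)| := by
      have : N ≤ |(n : ℝ)| := by
        by_contra h
        have h4 : |(n : ℝ)| ≤ ⌈N⌉ := (not_le.1 h).le.trans (Int.le_ceil N)
        rw [← Int.cast_abs] at h4
        exact hnF (Finset.mem_Icc.2 (abs_le.1 (by exact_mod_cast h4)))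
      rwa [hN, div_le_iff₀' hT] at this
    refine ⟨fun h => ?_, norm_appellTerm_le h2 h3 hlarge⟩
    have := norm_e_add_int_mul h2 h3 hlarge
    rw [h, norm_one] at this
    norm_num at this

/-- The level three Appell sum `∑ (-1)^n q^{3n²/2} (ζqⁿ)^{1/2} / (1 - ζqⁿ)`. -/
noncomputable def appell (z τ : ℂ) : ℂ := ∑' n, appellTerm z τ n

/-- The image of the Appell sum under the heat operator. -/
noncomputable def appellHeat (z τ : ℂ) : ℂ := ∑' n, appellTermHeat z τ n

section

variable {z τ : ℂ} (hτ : 0 < τ.im) (hz : ∀ n : ℤ, e (z + n * τ) ≠ 1)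
include hτ hz

theorem summable_appellTerm : Summable (appellTerm z τ) := by
  obtain ⟨ε, hε, u, hu, -, h⟩ := exists_appell_bound z hτ
  have h := (h z (Metric.mem_ball_self hε) τ (Metric.mem_ball_self hε)).2
  exact .of_norm_bounded hu fun n => (h n (hz n)).2.1

theorem summable_appellTermHeat : Summable (appellTermHeat z τ) := by
  obtain ⟨ε, hε, u, hu, -, h⟩ := exists_appell_bound z hτ
  have h := (h z (Metric.mem_ball_self hε) τ (Metric.mem_ball_self hε)).2
  exact .of_norm_bounded hu fun n => (h n (hz n)).2.2.2

/-- Openness of the pole-free locus, jointly in `z` and `τ`: identities valid on it may be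
differentiated. -/
theorem eventually_e_ne_one : ∀ᶠ p : ℂ × ℂ in 𝓝 (z, τ), 0 < p.2.im ∧
    ∀ n : ℤ, e (p.1 + n * p.2) ≠ 1 := by
  obtain ⟨ε, hε, u, hu, -, h⟩ := exists_appell_bound z hτ
  filter_upwards [Metric.ball_mem_nhds (z, τ) hε] with p hp
  rw [← ball_prod_same] at hp
  have h := h p.1 hp.1 p.2 hp.2
  exact ⟨h.1, fun n => (h.2 n (hz n)).1⟩

theorem differentiableAt_appell : DifferentiableAt ℂ (fun x => appell x τ) z := by
  obtain ⟨ε, hε, u, hu, -, h⟩ := exists_appell_bound z hτ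
  have h := fun x hx => (h x hx τ (Metric.mem_ball_self hε)).2
  exact (Complex.differentiableOn_tsum_of_summable_norm hu
    (fun n x hx => (hasDerivAt_appellTerm (h x hx n (hz n)).1).differentiableAt.differentiableWithinAt)
    Metric.isOpen_ball fun n x hx => (h x hx n (hz n)).2.1).differentiableAt
    (Metric.ball_mem_nhds z hε)

theorem differentiableAt_appellHeat : DifferentiableAt ℂ (fun x => appellHeat x τ) z := by
  obtain ⟨ε, hε, u, hu, -, h⟩ := exists_appell_bound z hτ
  have h := fun x hx => (h x hx τ (Metric.mem_ball_self hε)).2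
  exact (Complex.differentiableOn_tsum_of_summable_norm hu
    (fun n x hx => (differentiableAt_appellTermHeat (h x hx n (hz n)).1).differentiableWithinAt)
    Metric.isOpen_ball fun n x hx => (h x hx n (hz n)).2.2.2).differentiableAt
    (Metric.ball_mem_nhds z hε)

theorem differentiableAt_appell_tau : DifferentiableAt ℂ (fun t => appell z t) τ := by
  obtain ⟨ε, hε, u, hu, -, h⟩ := exists_appell_bound z hτ
  have h := fun t ht => (h z (Metric.mem_ball_self hε) t ht).2
  exact (Complex.differentiableOn_tsum_of_summable_norm hu
    (fun n t ht =>
      (hasDerivAt_appellTerm_tau (h t ht n (hz n)).1).differentiableAt.differentiableWithinAt)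
    Metric.isOpen_ball fun n t ht => (h t ht n (hz n)).2.1).differentiableAt
    (Metric.ball_mem_nhds τ hε)

theorem analyticAt_appell : AnalyticAt ℂ (fun x => appell x τ) z := by
  rw [Complex.analyticAt_iff_eventually_differentiableAt]
  have hc : ContinuousAt (fun x : ℂ => (x, τ)) z := by fun_prop
  filter_upwards [hc.eventually (eventually_e_ne_one hτ hz)] with x hx
  exact differentiableAt_appell hτ hx.2

/-- Weierstrass: the uniform bounds allow termwise differentiation. The first `z`-derivative is
computed on a whole ball so that it can be differentiated again. -/
theorem heat_appell : 6 * normDeriv (fun t => appell z t) τ +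
    normDeriv (normDeriv (fun x => appell x τ)) z = appellHeat z τ := by
  obtain ⟨ε, hε, u, hu, -, h⟩ := exists_appell_bound z hτ
  have hzb := Metric.mem_ball_self (x := z) hε
  have hτb := Metric.mem_ball_self (x := τ) hε
  have h1 := Complex.hasSum_deriv_of_summable_norm hu
    (fun n t ht => (hasDerivAt_appellTerm_tau
      ((h z hzb t ht).2 n (hz n)).1).differentiableAt.differentiableWithinAt)
    Metric.isOpen_ball (fun n t ht => ((h z hzb t ht).2 n (hz n)).2.1) hτb
  have h2 : ∀ x ∈ Metric.ball z ε, normDeriv (fun x => appell x τ) x = ∑' n, appellTermD x τ n := by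
    intro x hx
    have := Complex.hasSum_deriv_of_summable_norm hu
      (fun n x hx => (hasDerivAt_appellTerm
        ((h x hx τ hτb).2 n (hz n)).1).differentiableAt.differentiableWithinAt)
      Metric.isOpen_ball (fun n x hx => ((h x hx τ hτb).2 n (hz n)).2.1) hx
    rw [normDeriv]
    refine (this.mul_left (2 * Real.pi * Complex.I)⁻¹).tsum_eq.symm.trans ?_
    refine tsum_congr fun n => ?_
    rw [(hasDerivAt_appellTerm ((h x hx τ hτb).2 n (hz n)).1).deriv,
      inv_mul_cancel_left₀ Complex.two_pi_I_ne_zero]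
  have h3 := Complex.hasSum_deriv_of_summable_norm hu
    (fun n x hx => (hasDerivAt_appellTermD
      ((h x hx τ hτb).2 n (hz n)).1).differentiableAt.differentiableWithinAt)
    Metric.isOpen_ball (fun n x hx => ((h x hx τ hτb).2 n (hz n)).2.2.1) hzb
  have h4 : deriv (normDeriv (fun x => appell x τ)) z =
      deriv (fun x => ∑' n, appellTermD x τ n) z :=
    Filter.EventuallyEq.deriv_eq (by
      filter_upwards [Metric.ball_mem_nhds z hε] with x hx using h2 x hx)
  rw [normDeriv, normDeriv, h4]
  refine ((((h1.mul_left (2 * Real.pi * Complex.I)⁻¹).mul_left 6).add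
    (h3.mul_left (2 * Real.pi * Complex.I)⁻¹)).tsum_eq).symm.trans (tsum_congr fun n => ?_)
  rw [(hasDerivAt_appellTerm_tau (hz n)).deriv, (hasDerivAt_appellTermD (hz n)).deriv,
    inv_mul_cancel_left₀ Complex.two_pi_I_ne_zero, inv_mul_cancel_left₀ Complex.two_pi_I_ne_zero]
  simp only [appellTerm, appellTermD, appellTermHeat]
  ring

end

/-! ### Behaviour at the origin -/

theorem e_intCast_mul_ne_one {τ : ℂ} (hτ : 0 < τ.im) {n : ℤ} (hn : n ≠ 0) : e (n * τ) ≠ 1 := by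
  intro h
  obtain ⟨m, hm⟩ := e_eq_one_iff.1 h
  have := congrArg Complex.im hm
  simp only [Complex.mul_im, Complex.intCast_re, Complex.intCast_im, zero_mul, add_zero,
    mul_eq_zero, Int.cast_eq_zero] at this
  exact this.elim hn hτ.ne'

theorem eventually_e_ne_one_nhdsNE_zero {τ : ℂ} (hτ : 0 < τ.im) :
    ∀ᶠ z in 𝓝[≠] (0 : ℂ), ∀ n : ℤ, e (z + n * τ) ≠ 1 := by
  obtain ⟨ε, hε, u, hu, -, h⟩ := exists_appell_bound 0 hτ
  rw [eventually_nhdsWithin_iff]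
  filter_upwards [Metric.ball_mem_nhds (0 : ℂ) hε, Metric.ball_mem_nhds (0 : ℂ) one_pos]
    with z hz hz1 hz0 n
  rcases eq_or_ne n 0 with rfl | hn
  · intro h
    obtain ⟨m, hm⟩ := e_eq_one_iff.1 h
    simp only [Int.cast_zero, zero_mul, add_zero] at hm
    rw [mem_ball_zero_iff, hm, Complex.norm_intCast, ← Int.cast_abs] at hz1
    have : |m| < 1 := by exact_mod_cast hz1
    rw [Int.abs_lt_one_iff] at this
    exact hz0 (by simp [hm, this])
  · exact ((h z hz τ (Metric.mem_ball_self hε)).2 n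
      (by simpa using e_intCast_mul_ne_one hτ hn)).1

/-- At the origin, the Appell sum and its image under the heat operator are the terms of index `0`
up to continuous functions. -/
theorem exists_appell_eq_add {τ : ℂ} (hτ : 0 < τ.im) : ∃ F G : ℂ → ℂ,
    ContinuousAt F 0 ∧ ContinuousAt G 0 ∧ ∀ z, (∀ n : ℤ, e (z + n * τ) ≠ 1) →
      appell z τ = lerch z + F z ∧ appellHeat z τ = lerchDD z + G z := by
  obtain ⟨ε, hε, u, hu, hu0, h⟩ := exists_appell_bound 0 hτ
  have h := fun z hz n hn => (h z hz τ (Metric.mem_ball_self hε)).2 n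
    (by simpa using e_intCast_mul_ne_one hτ hn)
  refine ⟨fun z => ∑' n : ℤ, if n = 0 then 0 else appellTerm z τ n,
    fun z => ∑' n : ℤ, if n = 0 then 0 else appellTermHeat z τ n, ?_, ?_, ?_⟩
  · refine ((Complex.differentiableOn_tsum_of_summable_norm (U := Metric.ball 0 ε) hu (fun n z hz => ?_)
      Metric.isOpen_ball fun n z hz => ?_).differentiableAt
      (Metric.ball_mem_nhds 0 hε)).continuousAt
    · rcases eq_or_ne n 0 with rfl | hn
      · simpa using differentiableWithinAt_const 0
      · simp only [if_neg hn]
        exact (hasDerivAt_appellTerm (h z hz n hn).1).differentiableAt.differentiableWithinAt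
    · rcases eq_or_ne n 0 with rfl | hn
      · simpa using hu0 0
      · simpa only [if_neg hn] using (h z hz n hn).2.1
  · refine ((Complex.differentiableOn_tsum_of_summable_norm (U := Metric.ball 0 ε) hu (fun n z hz => ?_)
      Metric.isOpen_ball fun n z hz => ?_).differentiableAt
      (Metric.ball_mem_nhds 0 hε)).continuousAt
    · rcases eq_or_ne n 0 with rfl | hn
      · simpa using differentiableWithinAt_const 0
      · simp only [if_neg hn]
        exact (differentiableAt_appellTermHeat (h z hz n hn).1).differentiableWithinAt
    · rcases eq_or_ne n 0 with rfl | hn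
      · simpa using hu0 0
      · simpa only [if_neg hn] using (h z hz n hn).2.2.2
  · intro z hz
    constructor
    · rw [appell, (summable_appellTerm hτ hz).tsum_eq_add_tsum_ite 0]
      congr 1
      simp [appellTerm, e_zero]
    · rw [appellHeat, (summable_appellTermHeat hτ hz).tsum_eq_add_tsum_ite 0]
      congr 1
      simp [appellTermHeat, e_zero]

/-! ### Theta series and the eta function -/

/-- The terms of the theta series `∑ (-1)^n q^{(3n-a)²/6}`. -/
noncomputable def thetaTerm (a τ : ℂ) (n : ℤ) : ℂ := (-1) ^ n * e ((3 * n - a) ^ 2 / 6 * τ)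

theorem eta_eq_mul_qPochInf (τ : ℂ) :
    ModularForm.eta τ = e (τ / 24) * qPochInf (e τ) (e τ) := by
  rw [ModularForm.eta, qPochInf]
  congr 1
  · simp only [Function.Periodic.qParam, e]
    congr 1
    push_cast
    ring
  · refine tprod_congr fun n => ?_
    rw [ModularForm.eta_q_eq_pow, pow_succ']
    rfl

theorem norm_thetaTerm_half_le {T : ℝ} {τ : ℂ} (hT : 0 ≤ T) (hτ : T ≤ τ.im) (n : ℤ) :
    ‖thetaTerm (1 / 2) τ n‖ ≤
      |(n : ℝ)| ^ 0 * Real.exp (-Real.pi * (3 * T * n ^ 2 - 2 * (T / 2) * |(n : ℝ)|)) := by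
  have : (3 * (n : ℂ) - 1 / 2) ^ 2 / 6 * τ = (((3 * (n : ℝ) - 1 / 2) ^ 2 / 6 : ℝ) : ℂ) * τ := by
    push_cast; ring
  rw [thetaTerm, norm_mul, norm_neg_one_zpow, one_mul, pow_zero, one_mul, norm_e, this,
    Complex.im_ofReal_mul, Real.exp_le_exp]
  have h1 := mul_le_mul_of_nonneg_left hτ
    (mul_nonneg Real.pi_pos.le (sq_nonneg (3 * (n : ℝ) - 1 / 2)))
  have h2 := mul_le_mul_of_nonneg_left (le_abs_self (n : ℝ)) (mul_nonneg Real.pi_pos.le hT)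
  have h3 := mul_nonneg Real.pi_pos.le hT
  nlinarith

theorem summable_thetaTerm_bound {T : ℝ} (hT : 0 < T) : Summable fun n : ℤ =>
    |(n : ℝ)| ^ 0 * Real.exp (-Real.pi * (3 * T * n ^ 2 - 2 * (T / 2) * |(n : ℝ)|)) := by
  simpa only [Int.cast_abs] using
    summable_pow_mul_jacobiTheta₂_term_bound (T / 2) (T := 3 * T) (by positivity) 0

theorem summable_thetaTerm_half {τ : ℂ} (hτ : 0 < τ.im) : Summable (thetaTerm (1 / 2) τ) :=
  .of_norm_bounded (summable_thetaTerm_bound hτ) (norm_thetaTerm_half_le hτ.le le_rfl)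

/-- Completing the square in the pentagonal exponent: `n² + n(n-1)/2 + 1/24 = (3n - 1/2)²/6`. -/
theorem tsum_thetaTerm_half {τ : ℂ} (hτ : 0 < τ.im) :
    ∑' n, thetaTerm (1 / 2) τ n = ModularForm.eta τ := by
  rw [eta_eq_mul_qPochInf, ← tsum_pentagonal hτ, ← tsum_mul_left]
  refine tsum_congr fun n => ?_
  have : e ((3 * n - 1 / 2) ^ 2 / 6 * τ) =
      e (τ / 24) * e (n ^ 2 * τ) * e (τ * (n * (n - 1) / 2)) := by
    rw [← e_add, ← e_add]; congr 1; ring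
  rw [thetaTerm, this]
  ring

theorem hasSum_sq_mul_thetaTerm_half {τ : ℂ} (hτ : 0 < τ.im) :
    HasSum (fun n : ℤ => (3 * n - 1 / 2) ^ 2 * thetaTerm (1 / 2) τ n)
      (6 * normDeriv ModularForm.eta τ) := by
  have hT : 0 < τ.im / 2 := by positivity
  have hopen : IsOpen {t : ℂ | τ.im / 2 < t.im} := isOpen_lt continuous_const Complex.continuous_im
  have hmem : τ ∈ {t : ℂ | τ.im / 2 < t.im} := by
    simp only [Set.mem_ofPred_eq]; linarith
  have hd : ∀ (n : ℤ) (t : ℂ), HasDerivAt (fun t => thetaTerm (1 / 2) t n)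
      ((-1) ^ n * (2 * Real.pi * Complex.I * ((3 * n - 1 / 2) ^ 2 / 6 *
        e ((3 * n - 1 / 2) ^ 2 / 6 * t)))) t := fun n t =>
    (hasDerivAt_e_const_mul _ t).const_mul _
  have h := Complex.hasSum_deriv_of_summable_norm (summable_thetaTerm_bound hT)
    (fun n t _ => (hd n t).differentiableAt.differentiableWithinAt) hopen
    (fun n t ht => norm_thetaTerm_half_le hT.le (le_of_lt ht) n) hmem
  have heq : deriv (fun t => ∑' n, thetaTerm (1 / 2) t n) τ = deriv ModularForm.eta τ :=
    Filter.EventuallyEq.deriv_eq (by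
      filter_upwards [hopen.mem_nhds hmem] with t ht using tsum_thetaTerm_half (hT.trans ht))
  rw [heq] at h
  refine ((h.mul_left (2 * Real.pi * Complex.I)⁻¹).mul_left 6).congr_fun fun n => ?_
  rw [(hd n τ).deriv, thetaTerm]
  have := Complex.two_pi_I_ne_zero
  field_simp

/-- `6 𝒟η / η`. -/
noncomputable def etaLogDeriv (τ : ℂ) : ℂ := 6 * normDeriv ModularForm.eta τ / ModularForm.eta τ

/-- The terms of the theta series, with the weight `(3n-a)² - 6 𝒟η / η`. -/
noncomputable def thetaWeighted (a τ : ℂ) (n : ℤ) : ℂ :=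
  ((3 * n - a) ^ 2 - etaLogDeriv τ) * thetaTerm a τ n

/-- The value is `6𝒟η - (6𝒟η/η) η`. -/
theorem hasSum_thetaWeighted_half {τ : ℂ} (hτ : 0 < τ.im) :
    HasSum (thetaWeighted (1 / 2) τ) 0 := by
  have h := (hasSum_sq_mul_thetaTerm_half hτ).sub
    ((summable_thetaTerm_half hτ).hasSum.mul_left (etaLogDeriv τ))
  rw [tsum_thetaTerm_half hτ, etaLogDeriv, div_mul_cancel₀ _ (ModularForm.eta_ne_zero hτ),
    sub_self] at h
  refine h.congr_fun fun n => ?_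
  rw [thetaWeighted, etaLogDeriv]
  ring

/-- Exchanges `a = 1/2` and `a = 5/2`, and makes the series for `a = 3/2` antisymmetric. -/
theorem thetaWeighted_reflect (a τ : ℂ) (n : ℤ) :
    thetaWeighted a τ (1 - n) = -thetaWeighted (3 - a) τ n := by
  have h1 : (-1 : ℂ) ^ (1 - n) = -(-1) ^ n := by
    rw [zpow_sub₀ (by norm_num), zpow_one, div_eq_mul_inv, ← inv_zpow, inv_neg_one]
    ring
  have h2 : ((3 : ℂ) * (1 - n : ℤ) - a) ^ 2 = (3 * n - (3 - a)) ^ 2 := by push_cast; ring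
  rw [thetaWeighted, thetaWeighted, thetaTerm, thetaTerm, h1, h2]
  ring

theorem hasSum_thetaWeighted_five_halves {τ : ℂ} (hτ : 0 < τ.im) :
    HasSum (thetaWeighted (5 / 2) τ) 0 := by
  have h := ((Equiv.subLeft (1 : ℤ)).hasSum_iff.2 (hasSum_thetaWeighted_half hτ)).neg
  rw [neg_zero] at h
  refine h.congr_fun fun n => ?_
  rw [Function.comp, Equiv.subLeft_apply, thetaWeighted_reflect, neg_neg]
  norm_num

theorem tsum_thetaWeighted_three_halves (τ : ℂ) : ∑' n, thetaWeighted (3 / 2) τ n = 0 := by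
  have h := (Equiv.subLeft (1 : ℤ)).tsum_eq (thetaWeighted (3 / 2) τ)
  have h2 : ∀ n, thetaWeighted (3 / 2) τ (Equiv.subLeft (1 : ℤ) n) = -thetaWeighted (3 / 2) τ n := by
    intro n
    rw [Equiv.subLeft_apply, thetaWeighted_reflect]
    norm_num
  rw [tsum_congr h2, tsum_neg] at h
  linear_combination (-1 / 2 : ℂ) * h

/-! ### Quasi-periodicity of `rankHeat` -/

/-- The terms of `η` times the image of the normalized rank function under the heat operator. -/
noncomputable def rankHeatTerm (z τ : ℂ) (n : ℤ) : ℂ :=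
  appellTermHeat z τ n - etaLogDeriv τ * appellTerm z τ n

/-- `η` times the image of the normalized rank function under the heat operator. -/
noncomputable def rankHeat (z τ : ℂ) : ℂ := appellHeat z τ - etaLogDeriv τ * appell z τ

theorem hasSum_rankHeatTerm {z τ : ℂ} (hτ : 0 < τ.im) (hz : ∀ n : ℤ, e (z + n * τ) ≠ 1) :
    HasSum (rankHeatTerm z τ) (rankHeat z τ) :=
  (summable_appellTermHeat hτ hz).hasSum.sub
    ((summable_appellTerm hτ hz).hasSum.mul_left (etaLogDeriv τ))

theorem e_add_one (w : ℂ) : e (w + 1) = e w := by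
  rw [e_add, show (1 : ℂ) = ((1 : ℤ) : ℂ) by simp, e_int, mul_one]

theorem e_add_one_div_two (w : ℂ) : e ((w + 1) / 2) = -e (w / 2) := by
  rw [add_div, e_add, e_half, mul_neg_one]

theorem rankHeat_add_one (z τ : ℂ) : rankHeat (z + 1) τ = -rankHeat z τ := by
  have h1 : ∀ w, lerch (w + 1) = -lerch w := fun w => by
    rw [lerch, lerch, e_add_one_div_two, e_add_one, neg_div]
  have h2 : ∀ w, lerchD (w + 1) = -lerchD w := fun w => by
    rw [lerchD, lerchD, e_add_one_div_two, e_add_one, neg_mul, neg_div]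
  have h3 : ∀ w, lerchDD (w + 1) = -lerchDD w := fun w => by
    rw [lerchDD, lerchDD, e_add_one_div_two, e_add_one, neg_mul, neg_div]
  have h4 : appell (z + 1) τ = -appell z τ := by
    rw [appell, appell, ← tsum_neg]
    refine tsum_congr fun n => ?_
    rw [appellTerm, appellTerm, add_right_comm, h1, mul_neg]
  have h5 : appellHeat (z + 1) τ = -appellHeat z τ := by
    rw [appellHeat, appellHeat, ← tsum_neg]
    refine tsum_congr fun n => ?_
    rw [appellTermHeat, appellTermHeat, add_right_comm z 1, h1, h2, h3]
    ring
  rw [rankHeat, rankHeat, h4, h5]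
  ring

/-- The geometric sum `(ζ⁻³ - 1)/(1 - ζ) = ζ⁻¹ + ζ⁻² + ζ⁻³`, times `ζ^{1/2}`. -/
theorem lerch_shift {w : ℂ} (hw : e w ≠ 1) :
    e (-(3 * w)) * lerch w = lerch w + e (-(w / 2)) + e (-(3 * w / 2)) + e (-(5 * w / 2)) := by
  have h1 : 1 - e w ≠ 0 := sub_ne_zero.2 hw.symm
  have h0 := e_ne_zero (w / 2)
  have a1 : e (-(3 * w)) = (e (w / 2) ^ 6)⁻¹ := by
    rw [← e_natCast_mul, ← e_neg]; congr 1; push_cast; ring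
  have a2 : e (-(3 * w / 2)) = (e (w / 2) ^ 3)⁻¹ := by
    rw [← e_natCast_mul, ← e_neg]; congr 1; push_cast; ring
  have a3 : e (-(5 * w / 2)) = (e (w / 2) ^ 5)⁻¹ := by
    rw [← e_natCast_mul, ← e_neg]; congr 1; push_cast; ring
  rw [lerch, a1, a2, a3, e_neg]
  rw [← e_half_sq w] at h1 ⊢
  generalize e (w / 2) = x at *
  field_simp
  ring

/-- This is `(3n + 𝒟)²` applied to `lerch_shift`: passing `e(-3w)` lowers `n` by one, and `e(-aw)`
has eigenvalue `(3n - a)²`. -/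
theorem lerch_heat_shift {w : ℂ} (hw : e w ≠ 1) (n : ℂ) :
    e (-(3 * w)) * (9 * (n - 1) ^ 2 * lerch w + 6 * (n - 1) * lerchD w + lerchDD w) =
      9 * n ^ 2 * lerch w + 6 * n * lerchD w + lerchDD w + (3 * n - 1 / 2) ^ 2 * e (-(w / 2)) +
      (3 * n - 3 / 2) ^ 2 * e (-(3 * w / 2)) + (3 * n - 5 / 2) ^ 2 * e (-(5 * w / 2)) := by
  have h1 : 1 - e w ≠ 0 := sub_ne_zero.2 hw.symm
  have h0 := e_ne_zero (w / 2)
  have a1 : e (-(3 * w)) = (e (w / 2) ^ 6)⁻¹ := by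
    rw [← e_natCast_mul, ← e_neg]; congr 1; push_cast; ring
  have a2 : e (-(3 * w / 2)) = (e (w / 2) ^ 3)⁻¹ := by
    rw [← e_natCast_mul, ← e_neg]; congr 1; push_cast; ring
  have a3 : e (-(5 * w / 2)) = (e (w / 2) ^ 5)⁻¹ := by
    rw [← e_natCast_mul, ← e_neg]; congr 1; push_cast; ring
  rw [lerch, lerchD, lerchDD, a1, a2, a3, e_neg]
  rw [← e_half_sq w] at h1 ⊢
  generalize e (w / 2) = x at *
  field_simp
  ring

/-- The argument `w = z + nτ` is unchanged when `z` grows by `τ` and `n` drops by one, so only the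
exponentials change; completing squares turns the extra terms into theta terms. -/
theorem rankHeatTerm_shift {z τ : ℂ} {n : ℤ} (hz : e (z + n * τ) ≠ 1) :
    rankHeatTerm (z + τ) τ (n - 1) = -e (3 * z + 3 / 2 * τ) * (rankHeatTerm z τ n +
      e (-(z / 2) - τ / 24) * thetaWeighted (1 / 2) τ n +
      e (-(3 * z / 2) - 3 * τ / 8) * thetaWeighted (3 / 2) τ n +
      e (-(5 * z / 2) - 25 * τ / 24) * thetaWeighted (5 / 2) τ n) := by
  set w := z + n * τ with hw
  have h1 : z + τ + (n - 1 : ℤ) * τ = w := by rw [hw]; push_cast; ring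
  have h2 : (-1 : ℂ) ^ (n - 1) = -(-1) ^ n := by
    rw [zpow_sub_one₀ (by norm_num), inv_neg_one, mul_neg_one]
  have h3 : e (3 * (n - 1 : ℤ) ^ 2 / 2 * τ) =
      e (3 * z + 3 / 2 * τ) * e (3 * n ^ 2 / 2 * τ) * e (-(3 * w)) := by
    rw [← e_add, ← e_add, hw]; congr 1; push_cast; ring
  have t1 : e (-(z / 2) - τ / 24) * e ((3 * n - 1 / 2) ^ 2 / 6 * τ) =
      e (3 * n ^ 2 / 2 * τ) * e (-(w / 2)) := by
    rw [← e_add, ← e_add, hw]; congr 1; ring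
  have t2 : e (-(3 * z / 2) - 3 * τ / 8) * e ((3 * n - 3 / 2) ^ 2 / 6 * τ) =
      e (3 * n ^ 2 / 2 * τ) * e (-(3 * w / 2)) := by
    rw [← e_add, ← e_add, hw]; congr 1; ring
  have t3 : e (-(5 * z / 2) - 25 * τ / 24) * e ((3 * n - 5 / 2) ^ 2 / 6 * τ) =
      e (3 * n ^ 2 / 2 * τ) * e (-(5 * w / 2)) := by
    rw [← e_add, ← e_add, hw]; congr 1; ring
  have s1 := lerch_shift hz
  have s2 := lerch_heat_shift hz n
  simp only [rankHeatTerm, appellTerm, appellTermHeat, thetaWeighted, thetaTerm, h1, h2, h3,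
    ← hw]
  push_cast
  linear_combination (-(-1) ^ n * e (3 * z + 3 / 2 * τ)) * (e (3 * n ^ 2 / 2 * τ) *
      (s2 - etaLogDeriv τ * s1) - ((3 * n - 1 / 2) ^ 2 - etaLogDeriv τ) * t1 -
      ((3 * n - 3 / 2) ^ 2 - etaLogDeriv τ) * t2 - ((3 * n - 5 / 2) ^ 2 - etaLogDeriv τ) * t3)

theorem e_add_tau_ne_one {z τ : ℂ} (hz : ∀ n : ℤ, e (z + n * τ) ≠ 1) (m : ℤ) (n : ℤ) :
    e (z + m * τ + n * τ) ≠ 1 := by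
  have := hz (m + n)
  rwa [Int.cast_add, add_mul, ← add_assoc] at this

theorem rankHeat_add_tau {z τ : ℂ} (hτ : 0 < τ.im) (hz : ∀ n : ℤ, e (z + n * τ) ≠ 1) :
    rankHeat (z + τ) τ = -e (3 * z + 3 / 2 * τ) * rankHeat z τ := by
  have hz' : ∀ n : ℤ, e (z + τ + n * τ) ≠ 1 := by simpa using e_add_tau_ne_one hz 1
  have hE := neg_ne_zero.2 (e_ne_zero (3 * z + 3 / 2 * τ))
  have h1 := (Equiv.subRight (1 : ℤ)).hasSum_iff.2 (hasSum_rankHeatTerm hτ hz')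
  have h2 := ((((h1.mul_left (-e (3 * z + 3 / 2 * τ))⁻¹).sub (hasSum_rankHeatTerm hτ hz)).sub
    ((hasSum_thetaWeighted_half hτ).mul_left (e (-(z / 2) - τ / 24)))).sub
    ((hasSum_thetaWeighted_five_halves hτ).mul_left (e (-(5 * z / 2) - 25 * τ / 24))))
  -- Summability of the series for `a = 3/2` follows from that of the other four, so its `tsum`,
  -- known to be `0`, is its sum.
  have h3 := h2.congr_fun (g := fun n => e (-(3 * z / 2) - 3 * τ / 8) * thetaWeighted (3 / 2) τ n)
    fun n => by
      rw [Function.comp, Equiv.subRight_apply, rankHeatTerm_shift (hz n), inv_mul_cancel_left₀ hE]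
      ring
  have h4 := h3.tsum_eq
  rw [tsum_mul_left, tsum_thetaWeighted_three_halves, mul_zero] at h4
  simp only [mul_zero, sub_zero] at h4
  rw [← sub_eq_zero.1 h4.symm, mul_inv_cancel_left₀ hE]

/-! ### The reciprocal of the crank function -/

theorem differentiable_qPochInf {q : ℂ} (hq : ‖q‖ < 1) : Differentiable ℂ fun a => qPochInf a q := by
  intro a
  have h : HasProdLocallyUniformlyOn (fun (j : ℕ) (a : ℂ) => 1 + -(a * q ^ j))
      (fun a => ∏' j : ℕ, (1 + -(a * q ^ j))) (Metric.ball 0 (‖a‖ + 1)) := by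
    refine Summable.hasProdLocallyUniformlyOn_nat_one_add Metric.isOpen_ball
      ((summable_geometric_of_lt_one (norm_nonneg q) hq).mul_left (‖a‖ + 1))
      (Eventually.of_forall fun j x hx => ?_) fun j => by fun_prop
    rw [mem_ball_zero_iff] at hx
    rw [norm_neg, norm_mul, norm_pow]
    exact mul_le_mul_of_nonneg_right hx.le (by positivity)
  have hd := h.differentiableOn (Eventually.of_forall fun s => by
    simpa [Finset.prod_fn] using DifferentiableOn.finsetProd (fun _ _ => by fun_prop))
    Metric.isOpen_ball
  simp only [← sub_eq_add_neg] at hd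
  exact hd.differentiableAt (Metric.isOpen_ball.mem_nhds (by simp))

/-- The quotient `(ζq;q)_∞ (ζ⁻¹q;q)_∞ / (q;q)_∞²`. -/
noncomputable def thetaQuot (z τ : ℂ) : ℂ :=
  qPochInf (e z * e τ) (e τ) * qPochInf ((e z)⁻¹ * e τ) (e τ) / qPochInf (e τ) (e τ) ^ 2

/-- The entire function `1 / (η 𝒞*)`. -/
noncomputable def crankInv (z τ : ℂ) : ℂ := (e (-(z / 2)) - e (z / 2)) * thetaQuot z τ

theorem differentiable_thetaQuot {τ : ℂ} (hτ : 0 < τ.im) :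
    Differentiable ℂ fun z => thetaQuot z τ := by
  have hQ := differentiable_qPochInf (norm_e_lt_one hτ)
  have he := differentiable_e
  have h1 : Differentiable ℂ fun z => qPochInf (e z * e τ) (e τ) :=
    hQ.comp (g := fun a => qPochInf a (e τ)) (by fun_prop)
  have h2 : Differentiable ℂ fun z => qPochInf ((e z)⁻¹ * e τ) (e τ) :=
    hQ.comp (g := fun a => qPochInf a (e τ)) (f := fun z => (e z)⁻¹ * e τ)
      (by fun_prop (disch := exact fun z => e_ne_zero z))
  exact (h1.mul h2).div_const _

theorem differentiable_crankInv {τ : ℂ} (hτ : 0 < τ.im) :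
    Differentiable ℂ fun z => crankInv z τ := by
  have h1 := differentiable_thetaQuot hτ
  have he := differentiable_e
  unfold crankInv
  fun_prop

theorem thetaQuot_zero {τ : ℂ} (hτ : 0 < τ.im) : thetaQuot 0 τ = 1 := by
  have := qPochInf_self_ne_zero (norm_e_lt_one hτ)
  rw [thetaQuot, e_zero, inv_one, one_mul, ← sq, div_self (pow_ne_zero 2 this)]

theorem crankInv_zero (τ : ℂ) : crankInv 0 τ = 0 := by simp [crankInv]

/-- The first factor of `crankInv` is `1 / lerch z`: its zero cancels the pole of the kernel. -/
theorem lerch_mul_crankInv {z : ℂ} (hz : e z ≠ 1) (τ : ℂ) :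
    lerch z * crankInv z τ = thetaQuot z τ := by
  have h1 : 1 - e z ≠ 0 := sub_ne_zero.2 hz.symm
  have h0 := e_ne_zero (z / 2)
  rw [lerch, crankInv, e_neg]
  rw [← e_half_sq z] at h1 ⊢
  field_simp

theorem crankInv_add_one (z τ : ℂ) : crankInv (z + 1) τ = -crankInv z τ := by
  rw [crankInv, crankInv, thetaQuot, thetaQuot, e_add_one, e_neg, e_neg, e_add_one_div_two, inv_neg]
  ring

/-- The shift removes one factor from the first product and adds one to the second. The cube of the
multiplier is inverse to that of `rankHeat`. -/
theorem crankInv_add_tau {τ : ℂ} (hτ : 0 < τ.im) (z : ℂ) :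
    crankInv (z + τ) τ = -e (-(z + τ / 2)) * crankInv z τ := by
  have hq := norm_e_lt_one hτ
  have h1 := qPochInf_eq_mul (e z * e τ) hq
  have h2 := qPochInf_eq_mul ((e z)⁻¹) hq
  have a1 : e (-((z + τ) / 2)) = e (-(z / 2)) * e (-(τ / 2)) := by rw [← e_add]; congr 1; ring
  have a2 : e ((z + τ) / 2) = e (z / 2) * e (τ / 2) := by rw [← e_add]; congr 1; ring
  have a3 : e (-(z + τ / 2)) = (e z)⁻¹ * e (-(τ / 2)) := by
    rw [← e_neg, ← e_add]; congr 1; ring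
  have a4 : (e z * e τ)⁻¹ * e τ = (e z)⁻¹ := by
    have := e_ne_zero τ
    have := e_ne_zero z
    field_simp
  rw [crankInv, crankInv, thetaQuot, thetaQuot, e_add z τ, a1, a2, a3, a4, h1, h2, e_neg, e_neg]
  generalize qPochInf (e z * e τ * e τ) (e τ) = A
  generalize qPochInf ((e z)⁻¹ * e τ) (e τ) = B
  rw [← e_half_sq z, ← e_half_sq τ]
  have h3 := e_ne_zero (z / 2)
  have h4 := e_ne_zero (τ / 2)
  have h5 := qPochInf_self_ne_zero hq
  rw [← e_half_sq τ] at h5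
  generalize e (z / 2) = x at *
  generalize e (τ / 2) = y at *
  field_simp
  ring

theorem one_sub_mul_pow_ne_zero {z τ : ℂ} (hz : ∀ n : ℤ, e (z + n * τ) ≠ 1) (j : ℕ) :
    1 - e z * e τ * e τ ^ j ≠ 0 ∧ 1 - (e z)⁻¹ * e τ * e τ ^ j ≠ 0 := by
  constructor
  · rw [← e_natCast_mul, ← e_add, ← e_add, sub_ne_zero]
    convert! (hz (j + 1)).symm using 2
    push_cast
    ring
  · rw [← e_natCast_mul, ← e_neg, ← e_add, ← e_add, sub_ne_zero]
    convert! (e_neg_ne_one (hz (-(j + 1)))).symm using 2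
    push_cast
    ring

theorem eta_mul_crankStar_mul_crankInv {z τ : ℂ} (hτ : 0 < τ.im)
    (hz : ∀ n : ℤ, e (z + n * τ) ≠ 1) :
    ModularForm.eta τ * crankStar z τ * crankInv z τ = 1 := by
  have hq := norm_e_lt_one hτ
  have hz0 : e z ≠ 1 := by simpa using hz 0
  have h1 : 1 - e z ≠ 0 := sub_ne_zero.2 hz0.symm
  have hA := qPochInf_ne_zero hq fun j => (one_sub_mul_pow_ne_zero hz j).1
  have hB := qPochInf_ne_zero hq fun j => (one_sub_mul_pow_ne_zero hz j).2
  have hQ := qPochInf_self_ne_zero hq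
  have ht : e (τ / 24) * e (-τ / 24) = 1 := by
    rw [← e_add, ← e_zero]; congr 1; ring
  have h2 := lerch_mul_crankInv hz0 τ
  rw [thetaQuot] at h2
  calc _ = (e (τ / 24) * e (-τ / 24)) * (qPochInf (e τ) (e τ) ^ 2 /
        (qPochInf (e z * e τ) (e τ) * qPochInf ((e z)⁻¹ * e τ) (e τ))) *
        (lerch z * crankInv z τ) := by
        rw [eta_eq_mul_qPochInf, crankStar, crankGen, lerch]
        ring
    _ = 1 := by
        rw [ht, h2]
        generalize qPochInf ((e z)⁻¹ * e τ) (e τ) = B at hB ⊢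
        field_simp

/-! ### Liouville's theorem and the PDE -/

theorem rankStar_eq_appell_div_eta {z τ : ℂ} (hτ : 0 < τ.im)
    (hz : ∀ n : ℤ, e (z + n * τ) ≠ 1) : rankStar z τ = appell z τ / ModularForm.eta τ := by
  have hz0 : e z ≠ 1 := by simpa using hz 0
  have h1 : 1 - e z ≠ 0 := sub_ne_zero.2 hz0.symm
  have hQ := qPochInf_self_ne_zero (norm_e_lt_one hτ)
  have hterm : ∀ r : ℤ, e (r ^ 2 * τ) * ((1 - e z) * ((-1) ^ r *
      e (τ * (r * (r + 1) / 2)) / (1 - e (z + r * τ)))) =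
      (1 - e z) * e (-(z / 2)) * appellTerm z τ r := by
    intro r
    -- The exponent is `3r²/2 + r/2`; the part `q^{r/2}` goes into `(ζq^r)^{1/2}`, at the cost of
    -- `ζ^{-1/2}`.
    have h : e (r ^ 2 * τ) * e (τ * (r * (r + 1) / 2)) =
        e (-(z / 2)) * e (3 * r ^ 2 / 2 * τ) * e ((z + r * τ) / 2) := by
      rw [← e_add, ← e_add, ← e_add]; congr 1; ring
    rw [appellTerm, lerch]
    linear_combination ((1 - e z) * (-1) ^ r / (1 - e (z + r * τ))) * h
  rw [rankStar, rankGen, (hasSum_rankTerm hτ hz).tsum_eq, tsum_congr hterm, tsum_mul_left,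
    eta_eq_mul_qPochInf, ← appell, e_neg, neg_div, e_neg]
  have := e_ne_zero (z / 2)
  have := e_ne_zero (τ / 24)
  field_simp

theorem forall_e_ne_one_iff {z τ : ℂ} :
    (∀ n : ℤ, e (z + n * τ) ≠ 1) ↔ ∀ m n : ℤ, z ≠ m * τ + n := by
  simp only [ne_eq, e_eq_one_iff, not_exists]
  constructor
  · intro h m n hz
    exact h (-m) n (by rw [hz]; push_cast; ring)
  · intro h n m hz
    exact h (-n) m (by rw [← hz]; push_cast; ring)

/-- A continuous doubly periodic function that is holomorphic off the period lattice is constant. -/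
theorem eq_of_doubly_periodic {f : ℂ → ℂ} {τ : ℂ} (hτ : 0 < τ.im) (h1 : ∀ z, f (z + 1) = f z)
    (h2 : ∀ z, f (z + τ) = f z)
    (hd : ∀ z, (∀ n : ℤ, e (z + n * τ) ≠ 1) → DifferentiableAt ℂ f z) (hc : ContinuousAt f 0)
    (z : ℂ) : f z = f 0 := by
  have hper : ∀ (m n : ℤ) (z : ℂ), f (z + (m * τ + n)) = f z := by
    intro m n z
    have a1 := (show Function.Periodic f τ from h2).int_mul m z
    have a2 := (show Function.Periodic f 1 from h1).int_mul n (z + m * τ)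
    rw [mul_one] at a2
    rw [← add_assoc, a2, a1]
  -- The singularity at `0` is removable; periodicity carries this to every lattice point.
  have h0 : DifferentiableAt ℂ f 0 :=
    (Complex.analyticAt_of_differentiable_on_punctured_nhds_of_continuousAt
      ((eventually_e_ne_one_nhdsNE_zero hτ).mono fun z hz => hd z hz) hc).differentiableAt
  have hdiff : Differentiable ℂ f := by
    intro z
    by_cases hz : ∀ n : ℤ, e (z + n * τ) ≠ 1
    · exact hd z hz
    · rw [forall_e_ne_one_iff] at hz
      push Not at hz
      obtain ⟨m, n, rfl⟩ := hz
      have : f = fun w => f (w - (m * τ + n)) := by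
        ext w
        rw [← hper m n (w - (m * τ + n)), sub_add_cancel]
      rw [this]
      refine DifferentiableAt.comp (g := f) _ ?_ (by fun_prop)
      rwa [sub_self]
  refine hdiff.apply_eq_apply_of_bounded ?_ z 0
  -- All values are attained on the compact period parallelogram, so `f` is bounded.
  set g : ℝ × ℝ → ℂ := fun p => f (p.1 * τ + p.2) with hg
  have hgc : Continuous g := hdiff.continuous.comp (by fun_prop)
  refine ((isCompact_Icc.prod isCompact_Icc).image hgc :
    IsCompact (g '' (Set.Icc (0 : ℝ) 1 ×ˢ Set.Icc (0 : ℝ) 1))).isBounded.subset ?_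
  rintro _ ⟨w, rfl⟩
  set a := w.im / τ.im with ha
  set b := w.re - a * τ.re with hb
  have hw : w = a * τ + b := by
    apply Complex.ext
    · simp [hb]
    · simp [ha, hτ.ne']
  refine ⟨(Int.fract a, Int.fract b), ⟨⟨Int.fract_nonneg a, (Int.fract_lt_one a).le⟩,
    ⟨Int.fract_nonneg b, (Int.fract_lt_one b).le⟩⟩, ?_⟩
  simp only [hg]
  rw [← hper ⌊a⌋ ⌊b⌋, Int.fract, Int.fract]
  congr 1
  rw [hw]
  push_cast
  ring

/-- Up to continuous terms `rankHeat` is `2L³` plus a multiple of `L`. Since `L · crankInv` tends to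
`1` and `crankInv` to `0`, only the cube survives. -/
theorem tendsto_rankHeat_mul_crankInv {τ : ℂ} (hτ : 0 < τ.im) :
    Tendsto (fun z => rankHeat z τ * crankInv z τ ^ 3) (𝓝[≠] 0) (𝓝 2) := by
  obtain ⟨F, G, hF, hG, h⟩ := exists_appell_eq_add hτ
  have hM := (differentiable_thetaQuot hτ 0).continuousAt
  have hL := (differentiable_crankInv hτ 0).continuousAt
  have hlim : Tendsto (fun z => thetaQuot z τ * crankInv z τ ^ 2 / 4 + 2 * thetaQuot z τ ^ 3 +
      (G z - etaLogDeriv τ * F z) * crankInv z τ ^ 3 -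
      etaLogDeriv τ * (thetaQuot z τ * crankInv z τ ^ 2)) (𝓝 0) (𝓝 2) := by
    have hc : ContinuousAt (fun z => thetaQuot z τ * crankInv z τ ^ 2 / 4 + 2 * thetaQuot z τ ^ 3 +
      (G z - etaLogDeriv τ * F z) * crankInv z τ ^ 3 -
      etaLogDeriv τ * (thetaQuot z τ * crankInv z τ ^ 2)) 0 := by fun_prop
    have := hc.tendsto
    rw [thetaQuot_zero hτ, crankInv_zero] at this
    simpa using this
  refine (hlim.mono_left nhdsWithin_le_nhds).congr' ?_
  filter_upwards [eventually_e_ne_one_nhdsNE_zero hτ] with z hz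
  have hz0 : e z ≠ 1 := by simpa using hz 0
  obtain ⟨h1, h2⟩ := h z hz
  rw [rankHeat, h1, h2, lerchDD_eq hz0, ← lerch_mul_crankInv hz0 τ]
  ring

open Classical in
theorem rankHeat_mul_crankInv {z τ : ℂ} (hτ : 0 < τ.im) (hz : ∀ n : ℤ, e (z + n * τ) ≠ 1) :
    rankHeat z τ * crankInv z τ ^ 3 = 2 := by
  -- The value `2` at lattice points is the limit there, which makes `f` continuous at `0`.
  set f : ℂ → ℂ := fun z => if ∀ n : ℤ, e (z + n * τ) ≠ 1 then
    rankHeat z τ * crankInv z τ ^ 3 else 2 with hf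
  have hgood : ∀ w, (∀ n : ℤ, e (w + n * τ) ≠ 1) → f w = rankHeat w τ * crankInv w τ ^ 3 :=
    fun w hw => if_pos hw
  have hf0 : f 0 = 2 := if_neg fun h => h 0 (by simp [e_zero])
  have hconst := eq_of_doubly_periodic (f := f) hτ ?_ ?_ ?_ ?_ z
  · rw [← hgood z hz, hconst, hf0]
  · intro w
    simp only [hf, add_right_comm w 1, e_add_one, rankHeat_add_one, crankInv_add_one]
    congr 1
    ring
  · intro w
    by_cases hw : ∀ n : ℤ, e (w + n * τ) ≠ 1
    · have hw' : ∀ n : ℤ, e (w + τ + n * τ) ≠ 1 := by simpa using e_add_tau_ne_one hw 1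
      have hE : e (3 * w + 3 / 2 * τ) * e (-(w + τ / 2)) ^ 3 = 1 := by
        rw [← e_natCast_mul, ← e_add, ← e_zero]; congr 1; push_cast; ring
      rw [hgood w hw, hgood _ hw', rankHeat_add_tau hτ hw, crankInv_add_tau hτ]
      linear_combination (rankHeat w τ * crankInv w τ ^ 3) * hE
    · have hw' : ¬ ∀ n : ℤ, e (w + τ + n * τ) ≠ 1 := fun h => hw fun n => by
        simpa using e_add_tau_ne_one h (-1) n
      simp only [hf, if_neg hw, if_neg hw']
  · intro w hw
    have h1 : DifferentiableAt ℂ (fun w => rankHeat w τ * crankInv w τ ^ 3) w := by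
      have a1 := differentiableAt_appell hτ hw
      have a2 := differentiableAt_appellHeat hτ hw
      have a3 := differentiable_crankInv hτ w
      unfold rankHeat
      fun_prop
    refine h1.congr_of_eventuallyEq ?_
    have hc : ContinuousAt (fun x : ℂ => (x, τ)) w := by fun_prop
    filter_upwards [hc.eventually (eventually_e_ne_one hτ hw)] with x hx using hgood x hx.2
  · rw [continuousAt_iff_punctured_nhds, hf0]
    refine (tendsto_rankHeat_mul_crankInv hτ).congr' ?_
    filter_upwards [eventually_e_ne_one_nhdsNE_zero hτ] with w hw using (hgood w hw).symm

/-- The rank-crank PDE, at every point `(z, τ)` with `Im τ > 0` and `z ∉ ℤτ + ℤ`, together with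
the convergence of the rank series and the existence of the derivatives which it involves. -/
theorem corollary1p3 (τ z : ℂ) (hτ : 0 < τ.im) (hz : ∀ m n : ℤ, z ≠ m * τ + n) :
    Summable (rankTerm (e z) (e τ)) ∧
    DifferentiableAt ℂ (fun t => rankStar z t) τ ∧
    AnalyticAt ℂ (fun x => rankStar x τ) z ∧
    2 * ModularForm.eta τ ^ 2 * crankStar z τ ^ 3 =
      6 * normDeriv (fun t => rankStar z t) τ +
        normDeriv (normDeriv (fun x => rankStar x τ)) z := by
  rw [← forall_e_ne_one_iff] at hz
  have hη := ModularForm.eta_ne_zero hτ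
  have hev := eventually_e_ne_one hτ hz
  have ht : (fun t => rankStar z t) =ᶠ[𝓝 τ] fun t => appell z t / ModularForm.eta t := by
    have hc : ContinuousAt (fun t : ℂ => (z, t)) τ := by fun_prop
    filter_upwards [hc.eventually hev] with t h using rankStar_eq_appell_div_eta h.1 h.2
  have hx : (fun x => rankStar x τ) =ᶠ[𝓝 z] fun x => appell x τ / ModularForm.eta τ := by
    have hc : ContinuousAt (fun x : ℂ => (x, τ)) z := by fun_prop
    filter_upwards [hc.eventually hev] with x h using rankStar_eq_appell_div_eta h.1 h.2
  have hdη := ModularForm.differentiableAt_eta_of_mem_upperHalfPlaneSet hτ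
  have hdA := differentiableAt_appell_tau hτ hz
  refine ⟨(hasSum_rankTerm hτ hz).summable, (hdA.div hdη hη).congr_of_eventuallyEq ht,
    ((analyticAt_appell hτ hz).div_const).congr hx.symm, ?_⟩
  have hD : ∀ (f : ℂ → ℂ) (c x : ℂ), normDeriv (fun x => f x / c) x = normDeriv f x / c := by
    intro f c x
    rw [normDeriv, normDeriv, deriv_div_const, mul_div_assoc]
  have hxD : normDeriv (normDeriv (fun x => rankStar x τ)) z =
      normDeriv (normDeriv fun x => appell x τ) z / ModularForm.eta τ := by
    rw [← hD, normDeriv, normDeriv]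
    congr 1
    refine Filter.EventuallyEq.deriv_eq ?_
    filter_upwards [hx.deriv] with x h
    rw [normDeriv, h, ← hD, normDeriv]
  have htD : normDeriv (fun t => rankStar z t) τ =
      (normDeriv (fun t => appell z t) τ * ModularForm.eta τ -
        appell z τ * normDeriv ModularForm.eta τ) / ModularForm.eta τ ^ 2 := by
    rw [normDeriv, ht.deriv_eq, deriv_fun_div hdA hdη hη, normDeriv, normDeriv]
    ring
  have hheat := heat_appell hτ hz
  have hK := eta_mul_crankStar_mul_crankInv hτ hz
  have hS := rankHeat_mul_crankInv hτ hz
  have hS' : rankHeat z τ = 2 * (ModularForm.eta τ * crankStar z τ) ^ 3 := by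
    have hK3 : (ModularForm.eta τ * crankStar z τ) ^ 3 * crankInv z τ ^ 3 = 1 := by
      rw [← mul_pow, hK, one_pow]
    linear_combination (ModularForm.eta τ * crankStar z τ) ^ 3 * hS - rankHeat z τ * hK3
  -- With `heat_appell`, `rankHeat` becomes the numerator that the quotient rule gives for `A / η`.
  rw [rankHeat, ← hheat, etaLogDeriv] at hS'
  rw [hxD, htD]
  field_simp at hS' ⊢
  linear_combination -hS'
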